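/- Theorem 1.3 (thm:main). Let $\Lambda$ be a finitely generated group with a finite generating set $S$, and let $|\gamma|$ denote the word length of $\gamma\in\Lambda$ with respect to $S$. Let $\lambda:\Lambda\to U(\ell^2(\Lambda))$, $\lambda(\gamma)[f](x)=f(\gamma^{-1}x)$, be the left regular representation, and let $\tau(a)=\langle\delta_e,a\,\delta_e\rangle$ for bounded operators $a$ on $\ell^2(\Lambda)$. For every $n\ge 1$ let $\pi_n:\Lambda\to U(n)$ be a random unitary representation of dimension $n$. Extend $\lambda$ and $\pi_n$ linearly to the group algebra $\mathbb{C}[\Lambda]$, which carries the involution $(\sum_\gamma\alpha_\gamma\gamma)^*=\sum_\gamma\bar\alpha_\gamma\gamma^{-1}$; norms of operators and matrices are operator norms, and $\operatorname{tr}M=\frac1n\operatorname{Tr}M$ is the normalized trace of an $n\times n$ matrix. Make the following two assumptions. (i) (Effective $\frac1n$-expansion.) There are a constant $C\ge 1$ and constants $u_k(\gamma)\in\mathbb{R}$ for all integers $k\ge 0$ and all $\gamma\in\Lambda$ such that $u_0(\gamma)=\tau(\lambda(\gamma))$ and $$\left|\mathbb{E}[\operatorname{tr}\pi_n(\gamma)]-\sum_{k=0}^{q-1}\frac{u_k(\gamma)}{n^k}\right|\le\frac{(Cq)^{Cq}}{n^q}$$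 for all $\gamma\in\Lambda$ and all integers $q\ge|\gamma|$ and $n\ge 1$ with $n\ge Cq^C$ (with the convention $0^0=1$ when $q=0$). (ii) ($u_1$ is tempered.) Extend $u_1$ linearly to $\mathbb{C}[\Lambda]$. For every self-adjoint $x\in\mathbb{C}[\Lambda]$, $$\limsup_{p\to\infty}|u_1(x^p)|^{1/p}\le\|\lambda(x)\|.$$ Then for every $x\in\mathbb{C}[\Lambda]$, $$\|\pi_n(x)\|\le\|\lambda(x)\|+o(1)\quad\text{with probability}\quad 1-o(1)\quad\text{as } n\to\infty,$$ that is, there is a deterministic sequence $\delta_n\to 0$ (which may depend on $x$) such that $\mathbb{P}\big[\|\pi_n(x)\|\le\|\lambda(x)\|+\delta_n\big]\to 1$. -/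

import Mathlib

open Filter Topology MeasureTheory
open scoped ENNReal

noncomputable section

namespace StrongConv

/-- The word length of `γ` with respect to `S`: the least length of a word in the letters
`S ∪ S⁻¹` that represents `γ`. -/
def wordLength {Λ : Type*} [Group Λ] (S : Finset Λ) (γ : Λ) : ℕ :=
  sInf {k : ℕ | ∃ w : List Λ, (∀ s ∈ w, s ∈ S ∨ s⁻¹ ∈ S) ∧ w.prod = γ ∧ w.length = k}

/-- The Hilbert space `ℓ²(Λ)`. -/
abbrev EllTwo (Λ : Type*) : Type _ := lp (fun _ : Λ => ℂ) 2

/-- Translation `f ↦ (x ↦ f (γ⁻¹ x))` preserves square summability. -/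
theorem memℓp_translate {Λ : Type*} [Group Λ] (γ : Λ) (f : EllTwo Λ) :
    Memℓp (fun x : Λ => f (γ⁻¹ * x)) 2 := by
  have hp : (0 : ℝ) < (2 : ℝ≥0∞).toReal := by norm_num
  have h := (lp.memℓp f).summable hp
  exact memℓp_gen ((Equiv.mulLeft γ⁻¹).summable_iff.mpr h)

/-- Left translation `f ↦ (x ↦ f (γ⁻¹ x))` as a linear isometric automorphism of `ℓ²(Λ)`. -/
def translate {Λ : Type*} [Group Λ] (γ : Λ) : EllTwo Λ ≃ₗᵢ[ℂ] EllTwo Λ where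
  toFun f := ⟨fun x => f (γ⁻¹ * x), memℓp_translate γ f⟩
  invFun f := ⟨fun x => f (γ⁻¹⁻¹ * x), memℓp_translate γ⁻¹ f⟩
  map_add' f g := by ext x; rfl
  map_smul' c f := by ext x; rfl
  left_inv f := by ext x; simp
  right_inv f := by ext x; simp
  norm_map' f := by
    have hp : (0 : ℝ) < (2 : ℝ≥0∞).toReal := by norm_num
    rw [lp.norm_eq_tsum_rpow hp, lp.norm_eq_tsum_rpow hp]
    congr 1
    exact (Equiv.mulLeft γ⁻¹).tsum_eq (fun x : Λ => ‖f x‖ ^ (2 : ℝ≥0∞).toReal)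

/-- The left regular representation `λ : Λ → U(ℓ²(Λ))`, `λ(γ)[f](x) = f (γ⁻¹ x)`. -/
def regularRep (Λ : Type*) [Group Λ] : Λ →* unitary (EllTwo Λ →L[ℂ] EllTwo Λ) :=
  (Unitary.linearIsometryEquiv (𝕜 := ℂ) (H := EllTwo Λ)).symm.toMonoidHom.comp
    { toFun := translate
      map_one' := by ext f x; simp [translate]
      map_mul' := fun a b => by ext f x; simp [translate, mul_assoc] }

theorem regularRep_apply {Λ : Type*} [Group Λ] (γ : Λ) (f : EllTwo Λ) (x : Λ) :
    (regularRep Λ γ : EllTwo Λ →L[ℂ] EllTwo Λ) f x = f (γ⁻¹ * x) := rfl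

/-- The linear extension to the group algebra `ℂ[Λ]` of a group homomorphism from `Λ` to the
unitary group of a complex `*`-algebra `A`: `∑ α_γ γ ↦ ∑ α_γ ρ(γ)`. -/
def extendRep {Λ A : Type*} [Group Λ] [Ring A] [StarRing A] [Algebra ℂ A]
    (ρ : Λ →* unitary A) : MonoidAlgebra ℂ Λ →ₐ[ℂ] A :=
  MonoidAlgebra.lift ℂ A Λ ((unitary A).subtype.comp ρ)

/-- `‖λ(x)‖`, the operator norm of `λ(x)` on `ℓ²(Λ)`. -/
def regularNorm {Λ : Type*} [Group Λ] (x : MonoidAlgebra ℂ Λ) : ℝ :=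
  ‖extendRep (regularRep Λ) x‖

/-- `‖π(x)‖`, the operator norm of the matrix `π(x)` acting on Euclidean space `ℂⁿ`. -/
def repNorm {Λ : Type*} [Group Λ] {n : ℕ} (π : Λ →* Matrix.unitaryGroup (Fin n) ℂ)
    (x : MonoidAlgebra ℂ Λ) : ℝ :=
  ‖Matrix.toEuclideanCLM (n := Fin n) (𝕜 := ℂ) (extendRep π x)‖

open Classical in
/-- The canonical trace `τ(a) = ⟨δ_e, a δ_e⟩`. -/
def canonicalTrace {Λ : Type*} [Group Λ] (a : EllTwo Λ →L[ℂ] EllTwo Λ) : ℂ :=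
  inner ℂ (lp.single 2 (1 : Λ) (1 : ℂ) : EllTwo Λ) (a (lp.single 2 (1 : Λ) (1 : ℂ)))

/-- The normalized trace `n⁻¹ Tr M` of an `n × n` matrix. -/
def normTrace {n : ℕ} (M : Matrix (Fin n) (Fin n) ℂ) : ℂ := M.trace / n

/-- The involution `(∑ α_γ γ)* = ∑ conj(α_γ) γ⁻¹` of the group algebra. -/
def involution {Λ : Type*} [Group Λ] (x : MonoidAlgebra ℂ Λ) : MonoidAlgebra ℂ Λ :=
  x.coeff.sum fun γ a => MonoidAlgebra.single γ⁻¹ (star a)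

/-- The linear extension `∑ α_γ γ ↦ ∑ α_γ v(γ)` to `ℂ[Λ]` of a function `v : Λ → ℝ`. -/
def linearExt {Λ : Type*} [Group Λ] (v : Λ → ℝ) (x : MonoidAlgebra ℂ Λ) : ℂ :=
  x.coeff.sum fun γ a => a * (v γ : ℂ)

/-- A family of random `n`-dimensional unitary representations `π n` of `Λ`, `n ≥ 1`, has an
effective `1/n`-expansion with constant `C` and coefficients `u`. Powers with exponents
involving `C` are real powers. -/
structure EffectiveExpansion {Λ : Type*} [Group Λ] (S : Finset Λ)
    {Ω : ℕ → Type*} [∀ n, MeasurableSpace (Ω n)] (P : ∀ n, Measure (Ω n))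
    (π : ∀ n, Ω n → Λ →* Matrix.unitaryGroup (Fin n) ℂ)
    (C : ℝ) (u : ℕ → Λ → ℝ) : Prop where
  one_le : 1 ≤ C
  zeroth : ∀ γ : Λ, (u 0 γ : ℂ) = canonicalTrace (regularRep Λ γ : EllTwo Λ →L[ℂ] EllTwo Λ)
  bound : ∀ (γ : Λ) (q n : ℕ), wordLength S γ ≤ q → 1 ≤ n → C * (q : ℝ) ^ C ≤ (n : ℝ) →
    ‖(∫ ω, normTrace (π n ω γ : Matrix (Fin n) (Fin n) ℂ) ∂(P n))
        - ∑ k ∈ Finset.range q, (u k γ : ℂ) / (n : ℂ) ^ k‖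
      ≤ (C * (q : ℝ)) ^ (C * (q : ℝ)) / (n : ℝ) ^ q

/-- The function `v` is tempered: for every self-adjoint `x ∈ ℂ[Λ]`,
`limsup_{p → ∞} |v(x^p)|^{1/p} ≤ ‖λ(x)‖`. The limsup is taken in `[0, ∞]`. -/
def Tempered {Λ : Type*} [Group Λ] (v : Λ → ℝ) : Prop :=
  ∀ x : MonoidAlgebra ℂ Λ, involution x = x →
    limsup (fun p : ℕ => ‖linearExt v (x ^ p)‖ₑ ^ (1 / (p : ℝ))) atTop
      ≤ ENNReal.ofReal (regularNorm x)

end StrongConv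

end

/-! By the C*-identity it suffices to treat y = c x*x with c > 0 chosen so that y has ℓ¹ norm at
most 1; then every π_n(y) is a positive contraction. Let ‖λ(y)‖ < r₀ < r₁ ≤ 1. Take a polynomial h
that maps [0, 1] to itself, is at least 1/2 on [r₁, 1], and has a coefficientwise majorant whose
value at r₀ is at most 1/16 (`exists_bump`). With f = h^p, an eigenvalue of π_n(y) above r₁ forces
Tr f(π_n(y)) ≥ 2^(-p), so by Markov's inequality it is enough that 2^p · n · E tr f(π_n(y)) tends to
0, where p = log₄ n rounded down.

The expectation is compared with u₀(f(y)) + u₁(f(y))/n. Both functionals grow at most geometrically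
on the powers of y, with ratio r₀: the first because it is a vector state composed with λ, the
second because it is tempered. Domination of coefficients then bounds both by a constant times
16^(-p), which beats 2^p · n ≤ 4 · 8^p.

The remainder must be O(n⁻²) with a constant polynomial in the degree q ~ p, whereas the expansion
itself only provides the constant (Cq)^(Cq). This is the polynomial method
(`EffectiveExpansion.abs_expectation_sub_le`): truncating the expansion at order q gives a
polynomial in 1/n of degree at most q. It is bounded at the points 1/n, n ≥ M, because the trace is
bounded there and the truncation error is at most (M/n)^q, for some M polynomial in q. Markov's
inequality for derivatives extends the bound to [0, 1/M] and then controls the second derivative,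
hence the Taylor remainder at 0. A diagonal argument finally replaces a fixed ε by δ_n → 0. -/

namespace StrongConv

/-! ### Markov inequalities and Taylor remainders for polynomials sampled at reciprocals of
integers. -/

open Polynomial in
/-- Markov's inequality for the derivative of a polynomial at an endpoint of a segment. -/
theorem abs_derivative_endpoint_le {P : ℝ[X]} {q : ℕ} (hP : P.natDegree ≤ q) {B a b : ℝ}
    (hB : 0 < B) (hbd : ∀ t ∈ Set.uIcc a b, |P.eval t| ≤ B) :
    |P.derivative.eval b| * |b - a| ≤ 2 * (q : ℝ) ^ 2 * B := by
  -- The Chebyshev extremal bound is one-sided; the sign `ε` yields both sides. `R` is `P`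
  -- transported to [-1, 1] with `b` at 1, where T_q' equals q²; the change of variable contributes
  -- the factor 2.
  have key : ∀ ε : ℝ, |ε| = 1 →
      ε * (P.derivative.eval b * (b - a)) ≤ 2 * (q : ℝ) ^ 2 * B := by
    intro ε hε
    set R : ℝ[X] := C (ε / B) * P.comp (C ((b - a) / 2) * X + C ((a + b) / 2)) with hR
    have hRdeg : R.degree ≤ q := by
      refine (degree_le_natDegree).trans ?_
      have h1 : R.natDegree ≤ q := by
        refine (natDegree_C_mul_le _ _).trans (natDegree_comp_le.trans ?_)
        calc P.natDegree * (C ((b - a) / 2) * X + C ((a + b) / 2)).natDegree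
            ≤ P.natDegree * 1 := Nat.mul_le_mul_left _ natDegree_linear_le
          _ ≤ q := by omega
      exact_mod_cast h1
    have hRb : ∀ t ∈ Set.Icc (-1 : ℝ) 1, |R.eval t| ≤ 1 := by
      intro t ht
      have hm : (b - a) / 2 * t + (a + b) / 2 ∈ Set.uIcc a b := by
        rw [← segment_eq_uIcc]
        exact ⟨(1 - t) / 2, (1 + t) / 2, by linarith [ht.2], by linarith [ht.1], by ring,
          by simp only [smul_eq_mul]; ring⟩
      have := hbd _ hm
      simp only [hR, eval_mul, eval_C, eval_comp, eval_add, eval_X, abs_mul, abs_div, hε,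
        abs_of_pos hB]
      rw [one_div, inv_mul_le_iff₀ hB]
      simpa using this
    have h := Chebyshev.eval_iterate_derivative_le_of_forall_abs_le_one (k := 1) le_rfl hRdeg hRb
    simp only [Function.iterate_one, Chebyshev.derivative_T_eval_one] at h
    have hd : R.derivative.eval 1 = ε / B * (P.derivative.eval b * ((b - a) / 2)) := by
      have : (b - a) / 2 + (a + b) / 2 = b := by ring
      simp only [hR, derivative_C_mul, derivative_comp, eval_mul, eval_C, eval_comp, eval_add,
        eval_X, derivative_add, derivative_X, derivative_C, mul_one, add_zero, this]
      ring
    rw [hd] at h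
    push_cast at h
    have h2 : ε * (P.derivative.eval b * (b - a)) =
        (ε / B * (P.derivative.eval b * ((b - a) / 2))) * (2 * B) := by
      field_simp
    rw [h2]
    nlinarith
  rw [← abs_mul]
  refine abs_le.2 ⟨?_, ?_⟩
  · have := key (-1) (by simp); linarith
  · have := key 1 (by simp); linarith

open Polynomial in
/-- A Markov type inequality on `[0, L]`. -/
theorem abs_derivative_le {P : ℝ[X]} {q : ℕ} (hP : P.natDegree ≤ q) {B L : ℝ}
    (hB : 0 < B) (hL : 0 < L) (hbd : ∀ t ∈ Set.Icc 0 L, |P.eval t| ≤ B) {t : ℝ}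
    (ht : t ∈ Set.Icc 0 L) : |P.derivative.eval t| ≤ 4 * (q : ℝ) ^ 2 / L * B := by
  -- One endpoint of [0, L] lies at distance at least L/2 from `t`, so `t` may be treated as an
  -- endpoint of a segment of at least half the length.
  have key : ∀ a ∈ Set.Icc 0 L, L / 2 ≤ |t - a| →
      |P.derivative.eval t| ≤ 4 * (q : ℝ) ^ 2 / L * B := by
    intro a ha hta
    have h := abs_derivative_endpoint_le hP (a := a) (b := t) hB fun s hs =>
      hbd s (Set.uIcc_subset_Icc ha ht hs)
    have h2 : |P.derivative.eval t| * (L / 2) ≤ 2 * (q : ℝ) ^ 2 * B :=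
      (mul_le_mul_of_nonneg_left hta (abs_nonneg _)).trans h
    rw [div_mul_eq_mul_div, le_div_iff₀ hL]
    linarith
  rcases le_total (L / 2) t with h | h
  · exact key 0 ⟨le_rfl, hL.le⟩ (by rw [sub_zero]; exact h.trans (le_abs_self t))
  · exact key L ⟨hL.le, le_rfl⟩ (by rw [abs_sub_comm]; exact le_trans (by linarith) (le_abs_self _))

open Polynomial in
theorem abs_eval_sub_le {P : ℝ[X]} {D L : ℝ}
    (hbd : ∀ t ∈ Set.Icc 0 L, |P.derivative.eval t| ≤ D) {s t : ℝ}
    (hs : s ∈ Set.Icc 0 L) (ht : t ∈ Set.Icc 0 L) : |P.eval t - P.eval s| ≤ D * |t - s| := by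
  have := Convex.norm_image_sub_le_of_norm_deriv_le (f := fun t => P.eval t) (C := D)
    (s := Set.Icc 0 L) (fun x _ => P.differentiableAt)
    (fun x hx => by rw [Polynomial.deriv]; exact hbd x hx) (convex_Icc 0 L) hs ht
  simpa using this

/-- Consecutive reciprocals differ by 1/(n(n+1)), which is at most 1/M² once n ≥ M. The point 0 is
not between two of them and is approximated by 1/M². -/
theorem exists_inv_natCast_near {M : ℕ} (hM : 1 ≤ M) {t : ℝ} (ht : t ∈ Set.Icc 0 (1 / (M : ℝ))) :
    ∃ n : ℕ, M ≤ n ∧ |t - 1 / (n : ℝ)| ≤ 1 / (M : ℝ) ^ 2 := by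
  have hM' : (1 : ℝ) ≤ M := by exact_mod_cast hM
  rcases ht.1.eq_or_lt with h | h
  · refine ⟨M ^ 2, by nlinarith, ?_⟩
    rw [← h, zero_sub, abs_neg, abs_of_nonneg (by positivity)]
    push_cast; rfl
  · set n := ⌊1 / t⌋₊ with hn
    have hMt : (M : ℝ) ≤ 1 / t := by
      rw [le_div_iff₀ h]
      have := mul_le_mul_of_nonneg_left ht.2 (by positivity : (0 : ℝ) ≤ M)
      rwa [mul_one_div_cancel (by positivity)] at this
    have hMn : M ≤ n := Nat.le_floor hMt
    have hMn' : (M : ℝ) ≤ n := by exact_mod_cast hMn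
    have hn0 : (0 : ℝ) < n := by linarith
    have h1 : (n : ℝ) ≤ 1 / t := Nat.floor_le (by positivity)
    have h2 : 1 / t < n + 1 := Nat.lt_floor_add_one _
    refine ⟨n, hMn, ?_⟩
    have h3 : t ≤ 1 / n := by rw [le_div_iff₀ hn0]; rw [le_div_iff₀ h] at h1; linarith
    have h4 : 1 / ((n : ℝ) + 1) ≤ t := by
      rw [div_le_iff₀ (by positivity)]; rw [div_lt_iff₀ h] at h2; linarith
    rw [abs_sub_comm, abs_of_nonneg (by linarith)]
    calc 1 / (n : ℝ) - t ≤ 1 / n - 1 / (n + 1) := by linarith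
      _ = 1 / (n * (n + 1)) := by field_simp; ring
      _ ≤ 1 / (M : ℝ) ^ 2 := by
        apply one_div_le_one_div_of_le (by positivity); nlinarith

open Polynomial in
/-- A polynomial of degree `≤ q` that is bounded at the points `1/n`, `n ≥ M`, is bounded on
the interval `[0, 1/M]`, provided that `M ≥ 8 q²`. -/
theorem abs_eval_le_of_inv_natCast {P : ℝ[X]} {q : ℕ} (hP : P.natDegree ≤ q) {B : ℝ} (hB : 0 < B)
    {M : ℕ} (hM : 1 ≤ M) (hMq : 8 * q ^ 2 ≤ M)
    (hbd : ∀ n : ℕ, M ≤ n → |P.eval (1 / (n : ℝ))| ≤ B) :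
    ∀ t ∈ Set.Icc 0 (1 / (M : ℝ)), |P.eval t| ≤ 2 * B := by
  have hM' : (1 : ℝ) ≤ M := by exact_mod_cast hM
  have hMq' : 8 * (q : ℝ) ^ 2 ≤ M := by exact_mod_cast hMq
  have hL : (0 : ℝ) < 1 / M := by positivity
  -- Self-improving bound: with A the maximum of |P|, the slope is at most 4q²MA and a sample point
  -- lies within 1/M² of the maximizer, so A ≤ A/2 + B when M ≥ 8q².
  obtain ⟨s, hs, hmax⟩ := isCompact_Icc.exists_isMaxOn
    (Set.nonempty_Icc.2 hL.le) (f := fun t => |P.eval t|) (by fun_prop)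
  intro t ht
  refine le_trans (hmax ht) ?_
  by_contra! hlt
  obtain ⟨n, hMn, hn⟩ := exists_inv_natCast_near hM hs
  have hn' : (M : ℝ) ≤ n := by exact_mod_cast hMn
  have hmem : 1 / (n : ℝ) ∈ Set.Icc 0 (1 / (M : ℝ)) :=
    ⟨by positivity, one_div_le_one_div_of_le (by linarith) hn'⟩
  set A := |P.eval s| with hA
  have hA0 : 0 < A := by change 2 * B < A at hlt; linarith
  have h1 := abs_eval_sub_le (P := P)
    (fun t ht => abs_derivative_le hP (B := A) hA0 hL (fun t ht => hmax ht) ht) hmem hs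
  have h2 : 4 * (q : ℝ) ^ 2 / (1 / (M : ℝ)) * A * |s - 1 / n| ≤ A / 2 := by
    calc 4 * (q : ℝ) ^ 2 / (1 / (M : ℝ)) * A * |s - 1 / n|
        ≤ 4 * (q : ℝ) ^ 2 / (1 / (M : ℝ)) * A * (1 / (M : ℝ) ^ 2) := by gcongr
      _ = (8 * (q : ℝ) ^ 2 / M) * (A / 2) := by field_simp; ring
      _ ≤ 1 * (A / 2) := by
        gcongr
        rw [div_le_one (by positivity)]; exact hMq'
      _ = A / 2 := one_mul _
  have h3 := hbd n hMn
  have h4 : A ≤ |P.eval s - P.eval (1 / (n : ℝ))| + |P.eval (1 / (n : ℝ))| := by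
    have := abs_add_le (P.eval s - P.eval (1 / (n : ℝ))) (P.eval (1 / (n : ℝ)))
    simpa [hA] using this
  change 2 * B < A at hlt
  linarith

open Polynomial in
/-- First order Taylor estimate at `0` for a polynomial of degree `≤ q` that is bounded
at the points `1/n`, `n ≥ M ≥ 8 q²`. -/
theorem abs_taylor_remainder_le {P : ℝ[X]} {q : ℕ} (hP : P.natDegree ≤ q) (hq : 1 ≤ q)
    {B : ℝ} (hB : 0 < B) {M : ℕ} (hM : 1 ≤ M) (hMq : 8 * q ^ 2 ≤ M)
    (hbd : ∀ n : ℕ, M ≤ n → |P.eval (1 / (n : ℝ))| ≤ B) {n : ℕ} (hn : M ≤ n) :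
    |P.eval (1 / (n : ℝ)) - P.coeff 0 - P.coeff 1 / n| ≤
      32 * (q : ℝ) ^ 4 * (M : ℝ) ^ 2 * B / (n : ℝ) ^ 2 := by
  have hM' : (1 : ℝ) ≤ M := by exact_mod_cast hM
  have hq' : (1 : ℝ) ≤ q := by exact_mod_cast hq
  have hn' : (M : ℝ) ≤ n := by exact_mod_cast hn
  have hn0 : (0 : ℝ) < n := by linarith
  have hL : (0 : ℝ) < 1 / M := by positivity
  have h0 := abs_eval_le_of_inv_natCast hP hB hM hMq hbd
  have h1 : ∀ t ∈ Set.Icc 0 (1 / (M : ℝ)), |P.derivative.eval t| ≤ 4 * (q : ℝ) ^ 2 * M * (2 * B) := by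
    intro t ht
    have := abs_derivative_le hP (by positivity) hL h0 ht
    rwa [div_div_eq_mul_div, div_one] at this
  have h2 : ∀ t ∈ Set.Icc 0 (1 / (M : ℝ)), |P.derivative.derivative.eval t| ≤
      4 * (q : ℝ) ^ 2 * M * (4 * (q : ℝ) ^ 2 * M * (2 * B)) := by
    intro t ht
    have := abs_derivative_le (P := P.derivative) (q := q)
      ((natDegree_derivative_le P).trans (by omega)) (by positivity) hL h1 ht
    rwa [div_div_eq_mul_div, div_one] at this
  set K := 4 * (q : ℝ) ^ 2 * M * (4 * (q : ℝ) ^ 2 * M * (2 * B)) with hK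
  have hsub : Set.Icc 0 (1 / (n : ℝ)) ⊆ Set.Icc 0 (1 / (M : ℝ)) :=
    Set.Icc_subset_Icc_right (one_div_le_one_div_of_le (by linarith) hn')
  have hK0 : 0 ≤ K := by positivity
  -- Without its linear term the polynomial has zero derivative at 0, so two mean value estimates
  -- with the second-derivative bound `K` give the quadratic remainder.
  have h3 : ∀ t ∈ Set.Icc 0 (1 / (n : ℝ)), |(P - C (P.coeff 1) * X).derivative.eval t| ≤ K / n := by
    intro t ht
    have := abs_eval_sub_le h2 (s := 0) (t := t) ⟨le_rfl, hL.le⟩ (hsub ht)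
    have h1 : P.derivative.eval 0 = P.coeff 1 := by
      rw [← coeff_zero_eq_eval_zero, coeff_derivative]; simp
    rw [h1, sub_zero, abs_of_nonneg ht.1] at this
    simp only [derivative_sub, derivative_C_mul, derivative_X, mul_one, eval_sub, eval_C]
    refine this.trans ?_
    rw [div_eq_mul_one_div]
    exact mul_le_mul_of_nonneg_left ht.2 hK0
  have h4 := abs_eval_sub_le h3 (s := 0) (t := 1 / n) ⟨le_rfl, by positivity⟩
    ⟨by positivity, le_rfl⟩
  rw [sub_zero, abs_of_nonneg (by positivity : (0 : ℝ) ≤ 1 / n)] at h4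
  have h5 : (P - C (P.coeff 1) * X).eval (1 / (n : ℝ)) - (P - C (P.coeff 1) * X).eval 0
      = P.eval (1 / (n : ℝ)) - P.coeff 0 - P.coeff 1 / n := by
    simp only [eval_sub, eval_mul, eval_C, eval_X, ← coeff_zero_eq_eval_zero]
    ring
  rw [h5] at h4
  refine h4.trans (le_of_eq ?_)
  rw [hK]; field_simp; ring

/-! ### Coefficient domination and bump polynomials. -/

section BumpPolynomials

open Polynomial

/-- The coefficients of `g` dominate the absolute values of the coefficients of `f`. -/
def CoeffDominated (f g : ℝ[X]) : Prop := ∀ j, |f.coeff j| ≤ g.coeff j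

namespace CoeffDominated

variable {f f₁ f₂ g g₁ g₂ : ℝ[X]}

theorem refl_one : CoeffDominated 1 1 := fun j => by
  rw [coeff_one]; split_ifs <;> simp

theorem refl_X_pow (a : ℕ) : CoeffDominated (X ^ a) (X ^ a) := fun j => by
  rw [coeff_X_pow]; split_ifs <;> simp

theorem add (h₁ : CoeffDominated f₁ g₁) (h₂ : CoeffDominated f₂ g₂) :
    CoeffDominated (f₁ + f₂) (g₁ + g₂) := fun j => by
  rw [coeff_add, coeff_add]
  exact (abs_add_le _ _).trans (add_le_add (h₁ j) (h₂ j))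

theorem neg (h : CoeffDominated f g) : CoeffDominated (-f) g := fun j => by
  rw [coeff_neg, abs_neg]; exact h j

theorem sub (h₁ : CoeffDominated f₁ g₁) (h₂ : CoeffDominated f₂ g₂) :
    CoeffDominated (f₁ - f₂) (g₁ + g₂) := by
  rw [sub_eq_add_neg]; exact h₁.add h₂.neg

theorem mul (h₁ : CoeffDominated f₁ g₁) (h₂ : CoeffDominated f₂ g₂) :
    CoeffDominated (f₁ * f₂) (g₁ * g₂) := fun j => by
  rw [coeff_mul, coeff_mul]
  refine (Finset.abs_sum_le_sum_abs _ _).trans (Finset.sum_le_sum fun k _ => ?_)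
  rw [abs_mul]
  exact mul_le_mul (h₁ _) (h₂ _) (abs_nonneg _) ((abs_nonneg _).trans (h₁ _))

theorem pow (h : CoeffDominated f g) (n : ℕ) : CoeffDominated (f ^ n) (g ^ n) := by
  induction n with
  | zero => simpa using refl_one
  | succ n ih => rw [pow_succ, pow_succ]; exact ih.mul h

theorem sum {ι : Type*} (s : Finset ι) {F G : ι → ℝ[X]} (h : ∀ i, CoeffDominated (F i) (G i)) :
    CoeffDominated (∑ i ∈ s, F i) (∑ i ∈ s, G i) := fun j => by
  rw [finsetSum_coeff, finsetSum_coeff]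
  exact (Finset.abs_sum_le_sum_abs _ _).trans (Finset.sum_le_sum fun i _ => h i j)

/-- If a seminorm grows at most geometrically on the powers of `y`, then it is controlled on
every polynomial in `y` by a dominating polynomial. -/
theorem seminorm_aeval_le {A : Type*} [Ring A] [Algebra ℝ A] (s : Seminorm ℝ A) {y : A} {C r : ℝ}
    (hs : ∀ j, s (y ^ j) ≤ C * r ^ j) (h : CoeffDominated f g) :
    s (aeval y f) ≤ C * g.eval r := by
  set N := max f.natDegree g.natDegree + 1
  rw [aeval_eq_sum_range' (n := N) (by omega), eval_eq_sum_range' (n := N) (by omega),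
    Finset.mul_sum]
  refine (Finset.le_sum_of_subadditive s (map_zero s).le (map_add_le_add s) _ _).trans
    (Finset.sum_le_sum fun j _ => ?_)
  rw [map_smul_eq_mul, Real.norm_eq_abs]
  calc |f.coeff j| * s (y ^ j) ≤ g.coeff j * (C * r ^ j) :=
        mul_le_mul (h j) (hs j) (apply_nonneg s _) ((abs_nonneg _).trans (h j))
    _ = C * (g.coeff j * r ^ j) := by ring

end CoeffDominated

/-- The polynomial `1 - (1 - X^a)^b`, which maps `[0, 1]` to itself and, for suitable `a` and `b`,
is small near `0` and at least `1/2` near `1`. -/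
noncomputable def bump (a b : ℕ) : ℝ[X] := 1 - (1 - X ^ a) ^ b

/-- A polynomial whose coefficients dominate those of `bump a b`. -/
noncomputable def bumpMajorant (a b : ℕ) : ℝ[X] := (1 + X ^ a) ^ b - 1

theorem eval_bump (a b : ℕ) (t : ℝ) : (bump a b).eval t = 1 - (1 - t ^ a) ^ b := by
  simp [bump]

theorem eval_bumpMajorant (a b : ℕ) (t : ℝ) :
    (bumpMajorant a b).eval t = (1 + t ^ a) ^ b - 1 := by
  simp [bumpMajorant]

/-- Both sides are X^a times a geometric sum, in 1 - X^a and in 1 + X^a respectively. Factoring out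
X^a removes the constant term, without which the majorant could not be small near 0. -/
theorem coeffDominated_bump (a b : ℕ) : CoeffDominated (bump a b) (bumpMajorant a b) := by
  have h1 : bump a b = X ^ a * ∑ i ∈ Finset.range b, (1 - X ^ a) ^ i := by
    have := mul_neg_geom_sum (1 - (X : ℝ[X]) ^ a) b
    rw [bump, ← this]; ring
  have h2 : bumpMajorant a b = X ^ a * ∑ i ∈ Finset.range b, (1 + X ^ a) ^ i := by
    have := mul_geom_sum (1 + (X : ℝ[X]) ^ a) b
    rw [bumpMajorant, ← this]; ring
  rw [h1, h2]
  exact (CoeffDominated.refl_X_pow a).mul (CoeffDominated.sum _ fun i =>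
    (CoeffDominated.refl_one.sub (CoeffDominated.refl_X_pow a)).pow i)

theorem natDegree_bump_le (a b : ℕ) : (bump a b).natDegree ≤ a * b := by
  refine (natDegree_sub_le _ _).trans (max_le (by simp) ?_)
  refine natDegree_pow_le.trans ?_
  rw [mul_comm]
  refine Nat.mul_le_mul_right _ ((natDegree_sub_le _ _).trans (max_le (by simp) (by simp)))

theorem eval_bump_mem_Icc (a b : ℕ) {t : ℝ} (ht : t ∈ Set.Icc (0 : ℝ) 1) :
    (bump a b).eval t ∈ Set.Icc (0 : ℝ) 1 := by
  have h1 : t ^ a ≤ 1 := pow_le_one₀ ht.1 ht.2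
  have h0 : 0 ≤ t ^ a := pow_nonneg ht.1 _
  rw [eval_bump]
  have h2 : (1 - t ^ a) ^ b ≤ 1 := pow_le_one₀ (by linarith) (by linarith)
  have h3 : 0 ≤ (1 - t ^ a) ^ b := pow_nonneg (by linarith) _
  constructor <;> linarith

/-- Thresholds `r₀ < r₁` can be separated by a bump polynomial. -/
theorem exists_bump {r₀ r₁ : ℝ} (h0 : 0 ≤ r₀) (h01 : r₀ < r₁) (h1 : r₁ ≤ 1) :
    ∃ a b : ℕ, (bumpMajorant a b).eval r₀ ≤ 1 / 16 ∧
      ∀ t ∈ Set.Icc r₁ 1, 1 / 2 ≤ (bump a b).eval t := by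
  have hr1 : 0 < r₁ := h0.trans_lt h01
  -- The choice b ≈ r₁^(-a) puts the transition at r₁: b t^a ≥ 1 for t ≥ r₁, while b r₀^a ≤ 2
  -- (r₀/r₁)^a ≤ 1/32. Comparison with exponentials does the rest.
  obtain ⟨a, ha⟩ := exists_pow_lt_of_lt_one (by norm_num : (0 : ℝ) < 1 / 64)
    ((div_lt_one hr1).2 h01)
  have hp : 0 < r₁ ^ a := pow_pos hr1 a
  have hp1 : r₁ ^ a ≤ 1 := pow_le_one₀ hr1.le h1
  set b := ⌈1 / r₁ ^ a⌉₊ with hb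
  have hb1 : 1 / r₁ ^ a ≤ b := Nat.le_ceil _
  have hb2 : (b : ℝ) < 1 / r₁ ^ a + 1 := Nat.ceil_lt_add_one (by positivity)
  have hone : 1 ≤ 1 / r₁ ^ a := by rw [le_div_iff₀ hp]; linarith
  refine ⟨a, b, ?_, fun t ht => ?_⟩
  · rw [eval_bumpMajorant]
    have hq : 0 ≤ r₀ ^ a := pow_nonneg h0 a
    have h3 : (b : ℝ) * r₀ ^ a ≤ 1 / 32 := by
      calc (b : ℝ) * r₀ ^ a ≤ (2 * (1 / r₁ ^ a)) * r₀ ^ a := by gcongr; linarith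
        _ = 2 * (r₀ / r₁) ^ a := by rw [div_pow]; ring
        _ ≤ 1 / 32 := by linarith
    have h4 : (1 + r₀ ^ a) ^ b ≤ Real.exp (b * r₀ ^ a) := by
      rw [Real.exp_nat_mul]
      gcongr
      have := Real.add_one_le_exp (r₀ ^ a); linarith
    have h5 : |(b : ℝ) * r₀ ^ a| ≤ 1 / 32 := by rwa [abs_of_nonneg (by positivity)]
    have h6 := (le_abs_self _).trans (Real.abs_exp_sub_one_le (h5.trans (by norm_num)))
    linarith
  · rw [eval_bump]
    have ht0 : 0 ≤ t := hr1.le.trans ht.1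
    have h2 : r₁ ^ a ≤ t ^ a := pow_le_pow_left₀ hr1.le ht.1 a
    have h3 : t ^ a ≤ 1 := pow_le_one₀ ht0 ht.2
    have h4 : (1 - t ^ a) ^ b ≤ Real.exp (-1) := by
      calc (1 - t ^ a) ^ b ≤ (Real.exp (-r₁ ^ a)) ^ b := by
            refine pow_le_pow_left₀ (by linarith) ?_ b
            have := Real.add_one_le_exp (-r₁ ^ a); linarith
        _ = Real.exp (b * (-r₁ ^ a)) := (Real.exp_nat_mul _ _).symm
        _ ≤ Real.exp (-1) := by
            apply Real.exp_le_exp.2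
            rw [div_le_iff₀ hp] at hb1; linarith
    have h5 : Real.exp (-1) ≤ 1 / 2 := by
      rw [Real.exp_neg, inv_le_comm₀ (Real.exp_pos _) (by norm_num)]
      have := Real.add_one_le_exp (1 : ℝ); linarith
    linarith

end BumpPolynomials

/-! ### The group algebra: ℓ¹ norm, involution, supports in balls, regular representation. -/

section GroupAlgebra

variable {Λ : Type*}

/-- The `ℂ`-linear extension of a function `v : Λ → ℂ` to the group algebra. -/
noncomputable def linExt (v : Λ → ℂ) : MonoidAlgebra ℂ Λ →ₗ[ℂ] ℂ where
  toFun x := x.coeff.sum fun γ a => a * v γ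
  map_add' x y := by
    rw [MonoidAlgebra.coeff_add, Finsupp.sum_add_index'] <;> intros <;> ring
  map_smul' c x := by
    rw [MonoidAlgebra.coeff_smul, Finsupp.sum_smul_index']
    · simp [Finsupp.mul_sum, mul_assoc]
    · simp

theorem linExt_apply (v : Λ → ℂ) (x : MonoidAlgebra ℂ Λ) :
    linExt v x = x.coeff.sum fun γ a => a * v γ := rfl

/-- The `ℓ¹` norm on the group algebra. -/
noncomputable def ellOne (Λ : Type*) : Seminorm ℝ (MonoidAlgebra ℂ Λ) where
  toFun x := x.coeff.sum fun _ a => ‖a‖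
  map_zero' := by simp
  add_le' x y := by
    classical
    have hx : x.coeff.support ⊆ x.coeff.support ∪ y.coeff.support := Finset.subset_union_left
    have hy : y.coeff.support ⊆ x.coeff.support ∪ y.coeff.support := Finset.subset_union_right
    rw [MonoidAlgebra.coeff_add, Finsupp.sum_of_support_subset _ Finsupp.support_add _ (by simp),
      Finsupp.sum_of_support_subset _ hx _ (by simp),
      Finsupp.sum_of_support_subset _ hy _ (by simp), ← Finset.sum_add_distrib]
    exact Finset.sum_le_sum fun γ _ => norm_add_le _ _
  neg' x := by simp [Finsupp.sum_neg_index]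
  smul' c x := by
    rw [MonoidAlgebra.coeff_smul, Finsupp.sum_smul_index']
    · simp [Finsupp.mul_sum]
    · simp

theorem ellOne_apply (x : MonoidAlgebra ℂ Λ) : ellOne Λ x = x.coeff.sum fun _ a => ‖a‖ := rfl

theorem ellOne_single (γ : Λ) (a : ℂ) : ellOne Λ (MonoidAlgebra.single γ a) = ‖a‖ := by
  simp [ellOne_apply]

theorem ellOne_sum_le {ι : Type*} (s : Finset ι) (F : ι → MonoidAlgebra ℂ Λ) :
    ellOne Λ (∑ i ∈ s, F i) ≤ ∑ i ∈ s, ellOne Λ (F i) :=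
  Finset.le_sum_of_subadditive _ (map_zero _).le (map_add_le_add _) _ _

theorem norm_linExt_le {v : Λ → ℂ} {x : MonoidAlgebra ℂ Λ} {B : ℝ}
    (h : ∀ γ ∈ x.coeff.support, ‖v γ‖ ≤ B) : ‖linExt v x‖ ≤ ellOne Λ x * B := by
  rw [linExt_apply, ellOne_apply, Finsupp.sum, Finsupp.sum, Finset.sum_mul]
  refine (norm_sum_le _ _).trans (Finset.sum_le_sum fun γ hγ => ?_)
  rw [norm_mul]
  exact mul_le_mul_of_nonneg_left (h γ hγ) (norm_nonneg _)

variable [Group Λ]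

theorem linearExt_eq_linExt (v : Λ → ℝ) (x : MonoidAlgebra ℂ Λ) :
    linearExt v x = linExt (fun γ => (v γ : ℂ)) x := rfl

theorem ellOne_mul_le (x y : MonoidAlgebra ℂ Λ) : ellOne Λ (x * y) ≤ ellOne Λ x * ellOne Λ y := by
  rw [MonoidAlgebra.mul_def, ellOne_apply x, ellOne_apply y]
  simp only [Finsupp.sum, Finset.sum_mul_sum]
  refine (ellOne_sum_le _ _).trans (Finset.sum_le_sum fun γ _ => ?_)
  refine (ellOne_sum_le _ _).trans (Finset.sum_le_sum fun δ _ => ?_)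
  rw [ellOne_single, norm_mul]

theorem ellOne_pow_le_one {x : MonoidAlgebra ℂ Λ} (hx : ellOne Λ x ≤ 1) (j : ℕ) :
    ellOne Λ (x ^ j) ≤ 1 := by
  induction j with
  | zero => rw [pow_zero, MonoidAlgebra.one_def, ellOne_single]; simp
  | succ j ih =>
    rw [pow_succ]
    exact (ellOne_mul_le _ _).trans (mul_le_one₀ ih (apply_nonneg _ _) hx)

theorem ellOne_involution_le (x : MonoidAlgebra ℂ Λ) :
    ellOne Λ (involution x) ≤ ellOne Λ x := by
  rw [involution, ellOne_apply x]
  refine (ellOne_sum_le _ _).trans (Finset.sum_le_sum fun γ _ => ?_)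
  rw [ellOne_single, norm_star]

section Rep

variable {A : Type*} [Ring A] [StarRing A] [Algebra ℂ A]

theorem extendRep_apply (ρ : Λ →* unitary A) (x : MonoidAlgebra ℂ Λ) :
    extendRep ρ x = x.coeff.sum fun γ a => a • (ρ γ : A) :=
  MonoidAlgebra.lift_apply _ _

theorem extendRep_single (ρ : Λ →* unitary A) (γ : Λ) (a : ℂ) :
    extendRep ρ (MonoidAlgebra.single γ a) = a • (ρ γ : A) :=
  MonoidAlgebra.lift_single _ _ _

theorem extendRep_involution [StarModule ℂ A] (ρ : Λ →* unitary A) (x : MonoidAlgebra ℂ Λ) :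
    extendRep ρ (involution x) = star (extendRep ρ x) := by
  rw [involution, extendRep_apply ρ x, map_finsuppSum, Finsupp.sum, Finsupp.sum, star_sum]
  refine Finset.sum_congr rfl fun γ _ => ?_
  rw [extendRep_single, star_smul, map_inv, ← Unitary.star_eq_inv, Unitary.coe_star]

end Rep

theorem norm_extendRep_le {A : Type*} [NormedRing A] [StarRing A] [NormedAlgebra ℂ A]
    (ρ : Λ →* unitary A) (hρ : ∀ γ, ‖(ρ γ : A)‖ ≤ 1) (x : MonoidAlgebra ℂ Λ) :
    ‖extendRep ρ x‖ ≤ ellOne Λ x := by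
  rw [extendRep_apply, ellOne_apply]
  refine (norm_sum_le _ _).trans (Finset.sum_le_sum fun γ _ => ?_)
  rw [norm_smul]
  exact mul_le_of_le_one_right (norm_nonneg _) (hρ γ)

theorem involution_single (γ : Λ) (a : ℂ) :
    involution (MonoidAlgebra.single γ a) = MonoidAlgebra.single γ⁻¹ (star a) := by
  rw [involution, MonoidAlgebra.coeff_single, Finsupp.sum_single_index (by simp)]

theorem involution_add (x y : MonoidAlgebra ℂ Λ) :
    involution (x + y) = involution x + involution y := by
  rw [involution, MonoidAlgebra.coeff_add, Finsupp.sum_add_index' (by simp) (by simp)]; rfl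

theorem involution_zero : involution (0 : MonoidAlgebra ℂ Λ) = 0 := by simp [involution]

theorem involution_involution (x : MonoidAlgebra ℂ Λ) : involution (involution x) = x := by
  induction x using MonoidAlgebra.induction_linear with
  | zero => simp [involution_zero]
  | add x y hx hy => rw [involution_add, involution_add, hx, hy]
  | single γ a => simp [involution_single]

theorem involution_mul (x y : MonoidAlgebra ℂ Λ) :
    involution (x * y) = involution y * involution x := by
  induction x using MonoidAlgebra.induction_linear with
  | zero => simp [involution_zero]
  | add x x' hx hx' => rw [add_mul, involution_add, hx, hx', involution_add, mul_add]
  | single γ a =>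
    induction y using MonoidAlgebra.induction_linear with
    | zero => simp [involution_zero]
    | add y y' hy hy' => rw [mul_add, involution_add, hy, hy', involution_add, add_mul]
    | single δ b =>
      simp [involution_single, MonoidAlgebra.single_mul_single, mul_comm]

theorem involution_real_smul (c : ℝ) (x : MonoidAlgebra ℂ Λ) :
    involution (c • x) = c • involution x := by
  induction x using MonoidAlgebra.induction_linear with
  | zero => simp [involution_zero]
  | add x y hx hy => rw [smul_add, involution_add, hx, hy, involution_add, smul_add]
  | single γ a => simp [involution_single]

section WordLength

variable {S : Finset Λ}

theorem exists_word (hS : Subgroup.closure (S : Set Λ) = ⊤) (γ : Λ) :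
    ∃ w : List Λ, (∀ s ∈ w, s ∈ S ∨ s⁻¹ ∈ S) ∧ w.prod = γ ∧ w.length = wordLength S γ := by
  have hne : {k : ℕ | ∃ w : List Λ, (∀ s ∈ w, s ∈ S ∨ s⁻¹ ∈ S) ∧ w.prod = γ ∧
      w.length = k}.Nonempty := by
    have hmem : γ ∈ Subgroup.closure (S : Set Λ) := hS ▸ Subgroup.mem_top γ
    rw [← SetLike.mem_coe, ← Subgroup.coe_toSubmonoid, Subgroup.closure_toSubmonoid] at hmem
    obtain ⟨w, hw, hp⟩ := Submonoid.exists_list_of_mem_closure hmem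
    exact ⟨_, w, fun s hs => by simpa using hw s hs, hp, rfl⟩
  exact Nat.sInf_mem hne

theorem wordLength_mul_le (hS : Subgroup.closure (S : Set Λ) = ⊤) (γ δ : Λ) :
    wordLength S (γ * δ) ≤ wordLength S γ + wordLength S δ := by
  obtain ⟨v, hv, hvp, hvl⟩ := exists_word hS γ
  obtain ⟨w, hw, hwp, hwl⟩ := exists_word hS δ
  refine Nat.sInf_le ⟨v ++ w, fun s hs => ?_, by simp [hvp, hwp], by simp [hvl, hwl]⟩
  rcases List.mem_append.1 hs with h | h
  exacts [hv s h, hw s h]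

theorem wordLength_one : wordLength S (1 : Λ) = 0 :=
  Nat.eq_zero_of_le_zero (Nat.sInf_le ⟨[], by simp, rfl, rfl⟩)

variable (S) in
/-- The elements of the group algebra that are supported in the ball of radius `q`. -/
noncomputable def supportedInBall (q : ℕ) : Submodule ℝ (MonoidAlgebra ℂ Λ) where
  carrier := {x | ∀ γ, x.coeff γ ≠ 0 → wordLength S γ ≤ q}
  zero_mem' := by simp
  add_mem' {x y} hx hy γ hγ := by
    by_cases h : x.coeff γ = 0
    · exact hy γ fun h' => hγ (by simp [h, h'])
    · exact hx γ h
  smul_mem' c x hx γ hγ := hx γ fun h => hγ (by simp [h])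

theorem supportedInBall_mono {q r : ℕ} (h : q ≤ r) :
    supportedInBall S q ≤ supportedInBall S r := fun _ hx γ hγ => (hx γ hγ).trans h

theorem exists_mem_supportedInBall (x : MonoidAlgebra ℂ Λ) : ∃ d, x ∈ supportedInBall S d :=
  ⟨x.coeff.support.sup (wordLength S), fun _ hγ =>
    Finset.le_sup (f := wordLength S) (Finsupp.mem_support_iff.2 hγ)⟩

theorem mul_mem_supportedInBall (hS : Subgroup.closure (S : Set Λ) = ⊤) {q r : ℕ}
    {x y : MonoidAlgebra ℂ Λ} (hx : x ∈ supportedInBall S q) (hy : y ∈ supportedInBall S r) :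
    x * y ∈ supportedInBall S (q + r) := by
  rw [MonoidAlgebra.mul_def]
  refine Submodule.sum_mem _ fun γ hγ => Submodule.sum_mem _ fun δ hδ => ?_
  intro η hη
  have : γ * δ = η := by
    by_contra hne
    exact hη (by simp [MonoidAlgebra.coeff_single, hne])
  subst this
  exact (wordLength_mul_le hS γ δ).trans
    (add_le_add (hx γ (Finsupp.mem_support_iff.1 hγ)) (hy δ (Finsupp.mem_support_iff.1 hδ)))

theorem pow_mem_supportedInBall (hS : Subgroup.closure (S : Set Λ) = ⊤) {d : ℕ}
    {x : MonoidAlgebra ℂ Λ} (hx : x ∈ supportedInBall S d) (j : ℕ) :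
    x ^ j ∈ supportedInBall S (d * j) := by
  induction j with
  | zero =>
    intro γ hγ
    have : (1 : Λ) = γ := by
      by_contra hne
      exact hγ (by simp [MonoidAlgebra.one_def, hne])
    rw [← this, wordLength_one]; exact Nat.zero_le _
  | succ j ih =>
    rw [pow_succ, mul_add, mul_one]
    exact mul_mem_supportedInBall hS ih hx

theorem aeval_mem_supportedInBall (hS : Subgroup.closure (S : Set Λ) = ⊤) {d k : ℕ}
    {x : MonoidAlgebra ℂ Λ} (hx : x ∈ supportedInBall S d) {f : Polynomial ℝ}
    (hf : f.natDegree ≤ k) : Polynomial.aeval x f ∈ supportedInBall S (d * k) := by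
  rw [Polynomial.aeval_eq_sum_range]
  refine Submodule.sum_mem _ fun j hj => Submodule.smul_mem _ _ ?_
  refine supportedInBall_mono (Nat.mul_le_mul_left d ?_) (pow_mem_supportedInBall hS hx j)
  rw [Finset.mem_range] at hj; omega

end WordLength

theorem aeval_extendRep {A : Type*} [Ring A] [StarRing A] [Algebra ℂ A]
    (ρ : Λ →* unitary A) (x : MonoidAlgebra ℂ Λ) (f : Polynomial ℝ) :
    extendRep ρ (Polynomial.aeval x f) =
      Polynomial.aeval (extendRep ρ x) (f.map (algebraMap ℝ ℂ)) := by
  rw [Polynomial.aeval_algHom_apply, Polynomial.aeval_map_algebraMap]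

section RegularRep

theorem norm_regularRep_le_one (γ : Λ) :
    ‖(regularRep Λ γ : EllTwo Λ →L[ℂ] EllTwo Λ)‖ ≤ 1 :=
  ContinuousLinearMap.opNorm_le_bound _ zero_le_one fun f => by
    rw [one_mul]; exact (translate γ).norm_map f |>.le

theorem norm_canonicalTrace_le (a : EllTwo Λ →L[ℂ] EllTwo Λ) : ‖canonicalTrace a‖ ≤ ‖a‖ := by
  classical
  have h1 : ‖(lp.single 2 (1 : Λ) (1 : ℂ) : EllTwo Λ)‖ = 1 := by
    rw [lp.norm_single (by norm_num)]; simp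
  have h2 := norm_inner_le_norm (𝕜 := ℂ) (lp.single 2 (1 : Λ) (1 : ℂ) : EllTwo Λ)
    (a (lp.single 2 (1 : Λ) (1 : ℂ)))
  have h3 := a.le_opNorm (lp.single 2 (1 : Λ) (1 : ℂ) : EllTwo Λ)
  rw [h1, mul_one] at h3
  rw [h1, one_mul] at h2
  unfold canonicalTrace
  convert h2.trans h3

theorem linExt_canonicalTrace (x : MonoidAlgebra ℂ Λ) :
    linExt (fun γ => canonicalTrace (regularRep Λ γ : EllTwo Λ →L[ℂ] EllTwo Λ)) x =
      canonicalTrace (extendRep (regularRep Λ) x) := by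
  rw [linExt_apply, extendRep_apply, canonicalTrace, Finsupp.sum, Finsupp.sum,
    sum_apply, inner_sum]
  refine Finset.sum_congr rfl fun γ _ => ?_
  rw [smul_apply, inner_smul_right]; rfl

/-- For u₀ this plays the part that temperedness plays for u₁, with constant 1 and no loss in the
ratio. -/
theorem norm_linExt_canonicalTrace_pow_le (x : MonoidAlgebra ℂ Λ) (j : ℕ) :
    ‖linExt (fun γ => canonicalTrace (regularRep Λ γ : EllTwo Λ →L[ℂ] EllTwo Λ)) (x ^ j)‖ ≤
      regularNorm x ^ j := by
  rw [linExt_canonicalTrace, map_pow]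
  refine (norm_canonicalTrace_le _).trans ?_
  cases j with
  | zero => rw [pow_zero, pow_zero]; exact ContinuousLinearMap.norm_id_le
  | succ j => exact norm_pow_le' _ j.succ_pos

theorem regularNorm_involution_mul_self (x : MonoidAlgebra ℂ Λ) :
    regularNorm (involution x * x) = regularNorm x ^ 2 := by
  rw [regularNorm, map_mul, extendRep_involution, CStarRing.norm_star_mul_self, sq]; rfl

theorem regularNorm_real_smul {c : ℝ} (hc : 0 ≤ c) (x : MonoidAlgebra ℂ Λ) :
    regularNorm (c • x) = c * regularNorm x := by
  have : c • x = (c : ℂ) • x := by ext; simp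
  rw [regularNorm, this, map_smul, norm_smul, Complex.norm_real, Real.norm_of_nonneg hc]; rfl

end RegularRep

end GroupAlgebra

open scoped ComplexOrder

/-! ### Spectral calculus for unitary representations by matrices. -/

section Matrices

open scoped Matrix.Norms.L2Operator

theorem norm_unitaryGroup_le_one {n : ℕ} (U : Matrix.unitaryGroup (Fin n) ℂ) :
    ‖(U : Matrix (Fin n) (Fin n) ℂ)‖ ≤ 1 := by
  rcases subsingleton_or_nontrivial (Matrix (Fin n) (Fin n) ℂ) with h | h
  · rw [norm_of_subsingleton]; exact zero_le_one
  · exact (CStarRing.norm_coe_unitary U).le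

theorem repNorm_eq {Λ : Type*} [Group Λ] {n : ℕ} (π : Λ →* Matrix.unitaryGroup (Fin n) ℂ)
    (x : MonoidAlgebra ℂ Λ) : repNorm π x = ‖extendRep π x‖ := rfl

theorem repNorm_le_ellOne {Λ : Type*} [Group Λ] {n : ℕ}
    (π : Λ →* Matrix.unitaryGroup (Fin n) ℂ) (x : MonoidAlgebra ℂ Λ) :
    repNorm π x ≤ ellOne Λ x :=
  norm_extendRep_le π (fun γ => norm_unitaryGroup_le_one (π γ)) x

theorem repNorm_involution_mul_self {Λ : Type*} [Group Λ] {n : ℕ}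
    (π : Λ →* Matrix.unitaryGroup (Fin n) ℂ) (x : MonoidAlgebra ℂ Λ) :
    repNorm π (involution x * x) = repNorm π x ^ 2 := by
  rw [repNorm_eq, map_mul, extendRep_involution, CStarRing.norm_star_mul_self, sq]; rfl

theorem repNorm_real_smul {Λ : Type*} [Group Λ] {n : ℕ}
    (π : Λ →* Matrix.unitaryGroup (Fin n) ℂ) {c : ℝ} (hc : 0 ≤ c) (x : MonoidAlgebra ℂ Λ) :
    repNorm π (c • x) = c * repNorm π x := by
  have : c • x = (c : ℂ) • x := by ext; simp
  rw [repNorm_eq, this, map_smul, norm_smul, Complex.norm_real, Real.norm_of_nonneg hc]; rfl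

theorem posSemidef_extendRep {Λ : Type*} [Group Λ] {n : ℕ}
    (π : Λ →* Matrix.unitaryGroup (Fin n) ℂ) {c : ℝ} (hc : 0 ≤ c) (x : MonoidAlgebra ℂ Λ) :
    (extendRep π (c • (involution x * x))).PosSemidef := by
  have : c • (involution x * x) = (c : ℂ) • (involution x * x) := by ext; simp
  rw [this, map_smul, map_mul, extendRep_involution]
  exact (Matrix.posSemidef_conjTranspose_mul_self _).smul (by exact_mod_cast hc)

/-- The eigenvalues of a positive semidefinite contraction determine its norm and the traces of
all polynomials in it. -/
theorem exists_eigenvalues {n : ℕ} {M : Matrix (Fin n) (Fin n) ℂ} (hM : M.PosSemidef)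
    (h1 : ‖M‖ ≤ 1) :
    ∃ μ : Fin n → ℝ, (∀ i, μ i ∈ Set.Icc (0 : ℝ) 1) ∧ ‖M‖ = ‖μ‖ ∧ ∀ f : Polynomial ℝ,
      (Polynomial.aeval M (f.map (algebraMap ℝ ℂ))).trace = ((∑ i, f.eval (μ i) : ℝ) : ℂ) := by
  set μ := hM.isHermitian.eigenvalues with hμ
  set U := hM.isHermitian.eigenvectorUnitary with hU
  have hspec : M = Unitary.conjStarAlgAut ℂ _ U (Matrix.diagonal (RCLike.ofReal ∘ μ)) :=
    hM.isHermitian.spectral_theorem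
  have hnorm : ‖M‖ = ‖μ‖ := by
    have h : ‖M‖ = ‖(Matrix.diagonal ((RCLike.ofReal : ℝ → ℂ) ∘ μ) : Matrix (Fin n) (Fin n) ℂ)‖ := by
      conv_lhs => rw [hspec]
      rw [Unitary.conjStarAlgAut_apply, ← Unitary.coe_star, CStarRing.norm_mul_coe_unitary,
        CStarRing.norm_coe_unitary_mul]
    rw [h, Matrix.l2_opNorm_diagonal]
    simp [Pi.norm_def]
  refine ⟨μ, fun i => ⟨hM.eigenvalues_nonneg i, ?_⟩, hnorm, fun f => ?_⟩
  · have := norm_le_pi_norm μ i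
    exact (le_abs_self _).trans (this.trans (hnorm ▸ h1))
  · have h2 : Polynomial.aeval M (f.map (algebraMap ℝ ℂ)) =
        Unitary.conjStarAlgAut ℂ _ U (Matrix.diagonal fun i => ((f.eval (μ i) : ℝ) : ℂ)) := by
      conv_lhs => rw [hspec]
      rw [Polynomial.aeval_algHom_apply (Unitary.conjStarAlgAut ℂ _ U)]
      congr 1
      -- Polynomials commute with the algebra map sending a vector to its diagonal matrix, so they
      -- act entrywise on the eigenvalues.
      have h3 := Polynomial.aeval_algHom_apply (Matrix.diagonalAlgHom (n := Fin n) (α := ℂ) ℂ)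
        ((RCLike.ofReal : ℝ → ℂ) ∘ μ) (f.map (algebraMap ℝ ℂ))
      simp only [Matrix.diagonalAlgHom_apply] at h3
      rw [h3]
      congr 1
      ext i
      rw [Polynomial.aeval_map_algebraMap, Polynomial.aeval_pi_apply₂]
      exact Polynomial.aeval_algebraMap_apply ℂ (μ i) f
    rw [h2, Unitary.conjStarAlgAut_apply, Matrix.trace_mul_comm, ← mul_assoc,
      Unitary.coe_star_mul_self, one_mul, Matrix.trace_diagonal]
    push_cast; rfl

theorem norm_normTrace_unitary_le {n : ℕ} (U : Matrix.unitaryGroup (Fin n) ℂ) :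
    ‖normTrace (U : Matrix (Fin n) (Fin n) ℂ)‖ ≤ 1 := by
  rw [normTrace, norm_div, Complex.norm_natCast]
  refine div_le_one_of_le₀ ?_ (by positivity)
  calc ‖(U : Matrix (Fin n) (Fin n) ℂ).trace‖ ≤ ∑ i : Fin n, ‖(U : Matrix (Fin n) (Fin n) ℂ) i i‖ :=
        norm_sum_le _ _
    _ ≤ ∑ _i : Fin n, (1 : ℝ) := Finset.sum_le_sum fun i _ => entry_norm_bound_of_unitary U.2 i i
    _ = n := by simp

end Matrices

section Deterministic

variable {Λ : Type*} [Group Λ] {n : ℕ} (π : Λ →* Matrix.unitaryGroup (Fin n) ℂ)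
  {y : MonoidAlgebra ℂ Λ} {f : Polynomial ℝ}

theorem normTrace_aeval_mem_Icc (hy : (extendRep π y).PosSemidef) (h1 : ellOne Λ y ≤ 1)
    (hf : ∀ t ∈ Set.Icc (0 : ℝ) 1, f.eval t ∈ Set.Icc (0 : ℝ) 1) :
    (normTrace (extendRep π (Polynomial.aeval y f))).re ∈ Set.Icc (0 : ℝ) 1 := by
  obtain ⟨μ, hμ, -, htr⟩ := exists_eigenvalues hy ((repNorm_le_ellOne π y).trans h1)
  rw [normTrace, aeval_extendRep, htr, Complex.div_natCast_re, Complex.ofReal_re]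
  refine ⟨div_nonneg (Finset.sum_nonneg fun i _ => (hf _ (hμ i)).1) (by positivity), ?_⟩
  refine div_le_one_of_le₀ ?_ (by positivity)
  calc ∑ i, f.eval (μ i) ≤ ∑ _i : Fin n, (1 : ℝ) := Finset.sum_le_sum fun i _ => (hf _ (hμ i)).2
    _ = n := by simp

/-- A norm above `r` means some eigenvalue above `r`. It alone contributes at least `c` to the
unnormalized trace, and the other eigenvalues contribute nonnegatively. -/
theorem le_mul_normTrace_aeval (hy : (extendRep π y).PosSemidef) (h1 : ellOne Λ y ≤ 1)
    (hf : ∀ t ∈ Set.Icc (0 : ℝ) 1, 0 ≤ f.eval t) {r c : ℝ} (hr : 0 ≤ r)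
    (hfr : ∀ t ∈ Set.Icc r 1, c ≤ f.eval t) (hn : 1 ≤ n) (hry : r < repNorm π y) :
    c ≤ n * (normTrace (extendRep π (Polynomial.aeval y f))).re := by
  obtain ⟨μ, hμ, hnorm, htr⟩ := exists_eigenvalues hy ((repNorm_le_ellOne π y).trans h1)
  have hn0 : (0 : ℝ) < n := by exact_mod_cast hn
  rw [normTrace, aeval_extendRep, htr, Complex.div_natCast_re, Complex.ofReal_re,
    mul_div_cancel₀ _ hn0.ne']
  obtain ⟨i, hi⟩ : ∃ i, r < μ i := by
    by_contra! hcon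
    refine hry.not_ge ?_
    change ‖_‖ ≤ r
    refine hnorm.le.trans ((pi_norm_le_iff_of_nonneg hr).2 fun i => ?_)
    rw [Real.norm_of_nonneg (hμ i).1]; exact hcon i
  exact (hfr _ ⟨hi.le, (hμ i).2⟩).trans
    (Finset.single_le_sum (f := fun i => f.eval (μ i)) (fun i _ => hf _ (hμ i)) (Finset.mem_univ i))

end Deterministic

/-! ### Expected traces and the resulting tail bound. -/

section Expectation

variable {Λ : Type*} [Group Λ] {Ω : Type*} [MeasurableSpace Ω] {P : Measure Ω} {n : ℕ}
  {π : Ω → Λ →* Matrix.unitaryGroup (Fin n) ℂ}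

theorem normTrace_extendRep (ρ : Λ →* Matrix.unitaryGroup (Fin n) ℂ) (z : MonoidAlgebra ℂ Λ) :
    normTrace (extendRep ρ z) =
      linExt (fun γ => normTrace (ρ γ : Matrix (Fin n) (Fin n) ℂ)) z := by
  rw [extendRep_apply, linExt_apply, normTrace, Finsupp.sum, Finsupp.sum, Matrix.trace_sum,
    Finset.sum_div]
  refine Finset.sum_congr rfl fun γ _ => ?_
  rw [Matrix.trace_smul, smul_eq_mul, mul_div_assoc]; rfl

theorem measurable_normTrace
    (hπ : ∀ γ i j, Measurable fun ω => (π ω γ : Matrix (Fin n) (Fin n) ℂ) i j) (γ : Λ) :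
    Measurable fun ω => normTrace (π ω γ : Matrix (Fin n) (Fin n) ℂ) := by
  unfold normTrace Matrix.trace
  exact (Finset.measurable_sum _ fun i _ => hπ γ i i).div_const _

theorem measurable_normTrace_extendRep
    (hπ : ∀ γ i j, Measurable fun ω => (π ω γ : Matrix (Fin n) (Fin n) ℂ) i j)
    (z : MonoidAlgebra ℂ Λ) : Measurable fun ω => normTrace (extendRep (π ω) z) := by
  simp_rw [normTrace_extendRep, linExt_apply, Finsupp.sum]
  exact Finset.measurable_sum _ fun γ _ => (measurable_normTrace hπ γ).const_mul _

theorem integrable_normTrace [IsFiniteMeasure P]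
    (hπ : ∀ γ i j, Measurable fun ω => (π ω γ : Matrix (Fin n) (Fin n) ℂ) i j) (γ : Λ) :
    Integrable (fun ω => normTrace (π ω γ : Matrix (Fin n) (Fin n) ℂ)) P :=
  Integrable.of_bound (measurable_normTrace hπ γ).aestronglyMeasurable 1
    (Eventually.of_forall fun ω => norm_normTrace_unitary_le (π ω γ))

theorem integrable_normTrace_extendRep [IsFiniteMeasure P]
    (hπ : ∀ γ i j, Measurable fun ω => (π ω γ : Matrix (Fin n) (Fin n) ℂ) i j)
    (z : MonoidAlgebra ℂ Λ) : Integrable (fun ω => normTrace (extendRep (π ω) z)) P := by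
  simp_rw [normTrace_extendRep, linExt_apply, Finsupp.sum]
  exact integrable_finsetSum _ fun γ _ => (integrable_normTrace hπ γ).const_mul _

theorem integral_normTrace_extendRep [IsFiniteMeasure P]
    (hπ : ∀ γ i j, Measurable fun ω => (π ω γ : Matrix (Fin n) (Fin n) ℂ) i j)
    (z : MonoidAlgebra ℂ Λ) :
    ∫ ω, normTrace (extendRep (π ω) z) ∂P =
      linExt (fun γ => ∫ ω, normTrace (π ω γ : Matrix (Fin n) (Fin n) ℂ) ∂P) z := by
  simp_rw [normTrace_extendRep, linExt_apply, Finsupp.sum]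
  rw [integral_finsetSum _ fun γ _ => (integrable_normTrace hπ γ).const_mul _]
  exact Finset.sum_congr rfl fun γ _ => integral_const_mul _ _

/-- Markov's inequality for the trace of a bump polynomial. -/
theorem prob_repNorm_gt_le [IsProbabilityMeasure P]
    (hπ : ∀ γ i j, Measurable fun ω => (π ω γ : Matrix (Fin n) (Fin n) ℂ) i j)
    {y : MonoidAlgebra ℂ Λ} {f : Polynomial ℝ}
    (hy : ∀ ω, (extendRep (π ω) y).PosSemidef) (h1 : ellOne Λ y ≤ 1)
    (hf : ∀ t ∈ Set.Icc (0 : ℝ) 1, f.eval t ∈ Set.Icc (0 : ℝ) 1) {r c : ℝ} (hr : 0 ≤ r)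
    (hc : 0 < c) (hfr : ∀ t ∈ Set.Icc r 1, c ≤ f.eval t) (hn : 1 ≤ n) :
    ENNReal.ofReal (1 - n * (∫ ω, normTrace (extendRep (π ω) (Polynomial.aeval y f)) ∂P).re / c) ≤
      P {ω | repNorm (π ω) y ≤ r} := by
  set g : Ω → ℝ := fun ω => n * (normTrace (extendRep (π ω) (Polynomial.aeval y f))).re with hg
  have hgm : Measurable g :=
    (Complex.measurable_re.comp (measurable_normTrace_extendRep hπ _)).const_mul _
  have hgi : Integrable g P := (integrable_normTrace_extendRep hπ _).re.const_mul _
  have hg0 : ∀ ω, 0 ≤ g ω := fun ω =>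
    mul_nonneg (by positivity) (normTrace_aeval_mem_Icc (π ω) (hy ω) h1 hf).1
  have hgE : ∫ ω, g ω ∂P =
      n * (∫ ω, normTrace (extendRep (π ω) (Polynomial.aeval y f)) ∂P).re := by
    rw [hg, integral_const_mul]
    congr 1
    exact integral_re (integrable_normTrace_extendRep hπ _)
  have hmarkov := mul_meas_ge_le_integral_of_nonneg (Eventually.of_forall hg0) hgi c
  -- Complements are taken for this event, defined by traces; the norm event only has to contain a
  -- set of known probability, so its measurability is never needed.
  have hms : MeasurableSet {ω | c ≤ g ω} := measurableSet_le measurable_const hgm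
  have hsub : {ω | c ≤ g ω}ᶜ ⊆ {ω | repNorm (π ω) y ≤ r} := by
    intro ω hω
    by_contra hcon
    exact hω (le_mul_normTrace_aeval (π ω) (hy ω) h1 (fun t ht => (hf t ht).1) hr hfr hn
      (not_le.1 hcon))
  refine le_trans ?_ (measure_mono hsub)
  rw [← ofReal_measureReal (μ := P) (s := {ω | c ≤ g ω}ᶜ), probReal_compl_eq_one_sub hms]
  refine ENNReal.ofReal_le_ofReal (sub_le_sub_left ?_ 1)
  rw [le_div_iff₀ hc, ← hgE]
  linarith

end Expectation

/-! ### Consequences of the effective expansion and of temperedness. -/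

section Expansion

variable {Λ : Type*} [Group Λ] {S : Finset Λ} {Ω : ℕ → Type*} [∀ n, MeasurableSpace (Ω n)]
  {P : ∀ n, Measure (Ω n)} [∀ n, IsProbabilityMeasure (P n)]
  {π : ∀ n, Ω n → Λ →* Matrix.unitaryGroup (Fin n) ℂ} {C : ℝ} {u : ℕ → Λ → ℝ}

/-- The expansion error is uniform over the ball of radius q, so linear extension to elements
supported there costs only the ℓ¹ norm. -/
theorem EffectiveExpansion.bound_linExt (hexp : EffectiveExpansion S P π C u)
    (hπ : ∀ (n : ℕ) (γ : Λ) (i j : Fin n),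
      Measurable fun ω => (π n ω γ : Matrix (Fin n) (Fin n) ℂ) i j)
    {q n : ℕ} {z : MonoidAlgebra ℂ Λ} (hz : z ∈ supportedInBall S q) (hn : 1 ≤ n)
    (hqn : C * (q : ℝ) ^ C ≤ n) :
    ‖∫ ω, normTrace (extendRep (π n ω) z) ∂(P n) -
        ∑ k ∈ Finset.range q, linearExt (u k) z / (n : ℂ) ^ k‖ ≤
      ellOne Λ z * ((C * (q : ℝ)) ^ (C * (q : ℝ)) / (n : ℝ) ^ q) := by
  have h : ∫ ω, normTrace (extendRep (π n ω) z) ∂(P n) -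
        ∑ k ∈ Finset.range q, linearExt (u k) z / (n : ℂ) ^ k =
      linExt (fun γ => (∫ ω, normTrace (π n ω γ : Matrix (Fin n) (Fin n) ℂ) ∂(P n)) -
        ∑ k ∈ Finset.range q, (u k γ : ℂ) / (n : ℂ) ^ k) z := by
    rw [integral_normTrace_extendRep (hπ n)]
    simp only [linearExt, linExt_apply, Finsupp.sum, mul_sub, Finset.sum_sub_distrib,
      Finset.mul_sum, Finset.sum_div]
    rw [Finset.sum_comm]
    simp only [mul_div_assoc]
  rw [h]
  exact norm_linExt_le fun γ hγ =>
    hexp.bound γ q n (hz γ (Finsupp.mem_support_iff.1 hγ)) hn hqn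

open Polynomial in
/-- The expected trace of a suitable element of the group algebra agrees with the first two terms of
its expansion, up to an error of order `n⁻²` whose constant is polynomial in the degree. -/
theorem EffectiveExpansion.abs_expectation_sub_le (hexp : EffectiveExpansion S P π C u)
    (hπ : ∀ (n : ℕ) (γ : Λ) (i j : Fin n),
      Measurable fun ω => (π n ω γ : Matrix (Fin n) (Fin n) ℂ) i j)
    {q M : ℕ} (hq : 2 ≤ q) {z : MonoidAlgebra ℂ Λ} (hz : z ∈ supportedInBall S q) {L : ℝ}
    (hL : 1 ≤ L) (hzL : ellOne Λ z ≤ L ^ q)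
    (hz1 : ∀ n, |(∫ ω, normTrace (extendRep (π n ω) z) ∂(P n)).re| ≤ 1)
    (hM : L * (C * q) ^ C ≤ M) (hMq : 8 * q ^ 2 ≤ M) {n : ℕ} (hn : M ≤ n) :
    |(∫ ω, normTrace (extendRep (π n ω) z) ∂(P n)).re - (linearExt (u 0) z).re -
        (linearExt (u 1) z).re / n| ≤ 65 * (q : ℝ) ^ 4 * (M : ℝ) ^ 2 / (n : ℝ) ^ 2 := by
  have hC := hexp.one_le
  have hq1 : (1 : ℝ) ≤ q := by exact_mod_cast (by omega : 1 ≤ q)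
  have hM1 : 1 ≤ M := by nlinarith
  set Q : ℝ[X] := ∑ k ∈ Finset.range q, Polynomial.C (linearExt (u k) z).re * X ^ k with hQ
  have hcoeff : ∀ k < q, Q.coeff k = (linearExt (u k) z).re := by
    intro k hk
    simp only [hQ, finsetSum_coeff, coeff_C_mul_X_pow]
    rw [Finset.sum_ite_eq, if_pos (Finset.mem_range.2 hk)]
  have hdeg : Q.natDegree ≤ q := natDegree_sum_le_of_forall_le _ _ fun k hk =>
    (natDegree_C_mul_X_pow_le _ _).trans (Finset.mem_range.1 hk).le
  have heval : ∀ n : ℕ, Q.eval (1 / (n : ℝ)) =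
      (∑ k ∈ Finset.range q, linearExt (u k) z / (n : ℂ) ^ k).re := by
    intro n
    simp only [hQ, eval_finsetSum, eval_mul, eval_C, eval_pow, eval_X, Complex.re_sum]
    refine Finset.sum_congr rfl fun k _ => ?_
    rw [← Nat.cast_pow, Complex.div_natCast_re, Nat.cast_pow, one_div, inv_pow, div_eq_mul_inv]
  have herr : ∀ n : ℕ, M ≤ n → |(∫ ω, normTrace (extendRep (π n ω) z) ∂(P n)).re -
      Q.eval (1 / (n : ℝ))| ≤ ((M : ℝ) / n) ^ 2 := by
    intro n hn
    have hn1 : 1 ≤ n := hM1.trans hn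
    have hn0 : (0 : ℝ) < n := by exact_mod_cast hn1
    have hMn : (M : ℝ) ≤ n := by exact_mod_cast hn
    -- Since C ≥ 1 gives C ≤ C^C, the threshold `M` already includes the range in which the
    -- expansion is assumed.
    have hCq : C * (q : ℝ) ^ C ≤ n := by
      refine le_trans ?_ (hM.trans hMn)
      rw [Real.mul_rpow (by linarith) (by linarith)]
      have h1 : C ≤ C ^ C := Real.self_le_rpow_of_one_le hC hC
      have h2 : 0 ≤ (q : ℝ) ^ C := by positivity
      calc C * (q : ℝ) ^ C ≤ C ^ C * (q : ℝ) ^ C := mul_le_mul_of_nonneg_right h1 h2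
        _ ≤ L * (C ^ C * (q : ℝ) ^ C) := le_mul_of_one_le_left (by positivity) hL
    have h := hexp.bound_linExt hπ hz hn1 hCq
    rw [heval, ← Complex.sub_re]
    refine (Complex.abs_re_le_norm _).trans (h.trans ?_)
    -- Writing (Cq)^(Cq) as the q-th power of (Cq)^C makes the whole error a q-th power of a
    -- quantity at most M/n ≤ 1; as q ≥ 2, it is at most (M/n)².
    rw [Real.rpow_mul_natCast (by positivity)]
    have hx0 : 0 ≤ (C * q) ^ C := by positivity
    calc ellOne Λ z * (((C * q) ^ C) ^ q / (n : ℝ) ^ q)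
        ≤ L ^ q * (((C * q) ^ C) ^ q / (n : ℝ) ^ q) := by gcongr
      _ = (L * (C * q) ^ C / n) ^ q := by rw [div_pow, mul_pow]; ring
      _ ≤ ((M : ℝ) / n) ^ q := by gcongr
      _ ≤ ((M : ℝ) / n) ^ 2 :=
          pow_le_pow_of_le_one (by positivity) (div_le_one_of_le₀ hMn hn0.le) hq
  have hbd : ∀ n : ℕ, M ≤ n → |Q.eval (1 / (n : ℝ))| ≤ 2 := by
    intro n hn
    have h1 := herr n hn
    have h2 : ((M : ℝ) / n) ^ 2 ≤ 1 :=
      pow_le_one₀ (by positivity) (div_le_one_of_le₀ (by exact_mod_cast hn) (by positivity))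
    have h3 := hz1 n
    rw [abs_le] at h1 h3 ⊢
    constructor <;> linarith [h1.1, h1.2, h3.1, h3.2]
  -- The bound 2 is 1 for the trace plus 1 for the truncation error. It gives 64 in the Taylor
  -- remainder, and the truncation error raises this to 65.
  have h1 := abs_taylor_remainder_le hdeg (by omega) two_pos hM1 hMq hbd hn
  rw [hcoeff 0 (by omega), hcoeff 1 (by omega)] at h1
  have h2 := herr n hn
  have h3 : ((M : ℝ) / n) ^ 2 ≤ (q : ℝ) ^ 4 * (M : ℝ) ^ 2 / (n : ℝ) ^ 2 := by
    rw [div_pow]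
    gcongr
    exact le_mul_of_one_le_left (by positivity) (one_le_pow₀ hq1)
  have h4 : 65 * (q : ℝ) ^ 4 * (M : ℝ) ^ 2 / (n : ℝ) ^ 2 =
      (q : ℝ) ^ 4 * (M : ℝ) ^ 2 / (n : ℝ) ^ 2 + 32 * (q : ℝ) ^ 4 * (M : ℝ) ^ 2 * 2 / (n : ℝ) ^ 2 := by
    ring
  rw [h4]
  refine le_trans ?_ (add_le_add (h2.trans h3) h1)
  refine le_trans (le_of_eq ?_) (abs_add_le _ _)
  congr 1; ring

/-- A tempered functional grows at most geometrically on powers. -/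
theorem Tempered.exists_bound {v : Λ → ℝ} (hv : Tempered v) {y : MonoidAlgebra ℂ Λ}
    (hy : involution y = y) {r : ℝ} (hr : regularNorm y < r) :
    ∃ K : ℝ, 0 ≤ K ∧ ∀ j, ‖linearExt v (y ^ j)‖ ≤ K * r ^ j := by
  have hr0 : 0 < r := (norm_nonneg _).trans_lt hr
  have hlt : limsup (fun p : ℕ => ‖linearExt v (y ^ p)‖ₑ ^ (1 / (p : ℝ))) atTop
      < ENNReal.ofReal r := (hv y hy).trans_lt ((ENNReal.ofReal_lt_ofReal_iff hr0).2 hr)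
  obtain ⟨N, hN⟩ := eventually_atTop.1 (eventually_lt_of_limsup_lt hlt)
  have htail : ∀ j, N + 1 ≤ j → ‖linearExt v (y ^ j)‖ ≤ r ^ j := by
    intro j hj
    have hj0 : (j : ℝ) ≠ 0 := by exact_mod_cast (by omega : j ≠ 0)
    have h1 := ENNReal.rpow_le_rpow (hN j (by omega)).le (Nat.cast_nonneg j)
    rw [← ENNReal.rpow_mul, one_div_mul_cancel hj0, ENNReal.rpow_one, ENNReal.rpow_natCast,
      ← ENNReal.ofReal_pow hr0.le, ← ofReal_norm] at h1
    exact (ENNReal.ofReal_le_ofReal_iff (by positivity)).1 h1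
  have hterm : ∀ i, 0 ≤ ‖linearExt v (y ^ i)‖ / r ^ i := fun i => by positivity
  -- The sum absorbs the finitely many powers before the limsup bound takes effect, including j = 0,
  -- where the exponent 1/j carries no information.
  refine ⟨1 + ∑ i ∈ Finset.range (N + 1), ‖linearExt v (y ^ i)‖ / r ^ i,
    add_nonneg zero_le_one (Finset.sum_nonneg fun i _ => hterm i), fun j => ?_⟩
  have hrj : 0 < r ^ j := pow_pos hr0 j
  rw [← div_le_iff₀ hrj]
  by_cases hj : j < N + 1
  · have := Finset.single_le_sum (fun i _ => hterm i) (Finset.mem_range.2 hj)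
    linarith
  · have h1 : ‖linearExt v (y ^ j)‖ / r ^ j ≤ 1 :=
      div_le_one_of_le₀ (htail j (by omega)) hrj.le
    have h2 := Finset.sum_nonneg fun i (_ : i ∈ Finset.range (N + 1)) => hterm i
    linarith

/-- Coefficients are compared in absolute value, so growth on powers suffices; no positivity or
spectral representation of the functional is involved. -/
theorem norm_linearExt_aeval_le {v : Λ → ℝ} {y : MonoidAlgebra ℂ Λ} {K r : ℝ}
    (h : ∀ j, ‖linearExt v (y ^ j)‖ ≤ K * r ^ j) {f g : Polynomial ℝ} (hfg : CoeffDominated f g) :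
    ‖linearExt v (Polynomial.aeval y f)‖ ≤ K * g.eval r :=
  hfg.seminorm_aeval_le
    ((normSeminorm ℝ ℂ).comp ((linExt fun γ => (v γ : ℂ)).restrictScalars ℝ)) h

end Expansion

/-! ### Growth of thresholds and diagonalization. -/

section Asymptotics

theorem tendsto_log_four : Tendsto (fun n : ℕ => Nat.log 4 n) atTop atTop :=
  tendsto_atTop.2 fun m => eventually_atTop.2
    ⟨4 ^ m, fun _ hn => (Nat.le_log_iff_pow_le (by norm_num)
      (Nat.pos_of_ne_zero (fun h => by simp [h] at hn)).ne').2 hn⟩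

theorem tendsto_pow_mul_half_pow (k : ℕ) :
    Tendsto (fun p : ℕ => (p : ℝ) ^ k * (1 / 2) ^ p) atTop (𝓝 0) :=
  tendsto_pow_const_mul_const_pow_of_lt_one k (by norm_num) (by norm_num)

/-- The thresholds for `n` appearing in the estimates grow polynomially in the degree. -/
theorem exists_threshold_le {C L : ℝ} (hC : 1 ≤ C) (hL : 1 ≤ L) (D : ℕ) :
    ∃ (A : ℝ) (k : ℕ) (M : ℕ → ℕ), ∀ p : ℕ, 1 ≤ p →
      L * (C * (D * p : ℕ)) ^ C ≤ M p ∧ 8 * (D * p) ^ 2 ≤ M p ∧ (M p : ℝ) ≤ A * (p : ℝ) ^ k := by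
  refine ⟨L * (C * D) ^ C + 1 + 8 * (D : ℝ) ^ 2, ⌈C⌉₊ + 2,
    fun p => ⌈L * (C * (D * p : ℕ)) ^ C⌉₊ + 8 * (D * p) ^ 2, fun p hp => ⟨?_, ?_, ?_⟩⟩
  · push_cast
    have := Nat.le_ceil (L * (C * (D * p)) ^ C)
    have : (0 : ℝ) ≤ 8 * (D * p) ^ 2 := by positivity
    linarith
  · exact Nat.le_add_left _ _
  · have hp1 : (1 : ℝ) ≤ p := by exact_mod_cast hp
    have hC0 : 0 ≤ C := by linarith
    have h1 : (⌈L * (C * (D * p : ℕ)) ^ C⌉₊ : ℝ) ≤ L * (C * (D * p : ℕ)) ^ C + 1 :=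
      (Nat.ceil_lt_add_one (by positivity)).le
    have h2 : (p : ℝ) ^ C ≤ (p : ℝ) ^ (⌈C⌉₊ + 2) := by
      rw [← Real.rpow_natCast]
      refine Real.rpow_le_rpow_of_exponent_le hp1 ((Nat.le_ceil C).trans ?_)
      push_cast; linarith
    have h3 : (p : ℝ) ^ 2 ≤ (p : ℝ) ^ (⌈C⌉₊ + 2) := pow_le_pow_right₀ hp1 (by omega)
    have h4 : (1 : ℝ) ≤ (p : ℝ) ^ (⌈C⌉₊ + 2) := one_le_pow₀ hp1
    have h5 : (C * (D * p : ℕ)) ^ C = (C * D) ^ C * (p : ℝ) ^ C := by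
      push_cast
      rw [← mul_assoc, Real.mul_rpow (by positivity) (by positivity)]
    have h6 : ((⌈L * (C * (D * p : ℕ)) ^ C⌉₊ + 8 * (D * p) ^ 2 : ℕ) : ℝ) =
        ⌈L * (C * (D * p : ℕ)) ^ C⌉₊ + 8 * (D : ℝ) ^ 2 * (p : ℝ) ^ 2 := by
      push_cast; ring
    refine h6.le.trans ?_
    calc (⌈L * (C * (D * p : ℕ)) ^ C⌉₊ : ℝ) + 8 * (D : ℝ) ^ 2 * (p : ℝ) ^ 2
        ≤ (L * ((C * D) ^ C * (p : ℝ) ^ C) + 1) + 8 * (D : ℝ) ^ 2 * (p : ℝ) ^ 2 := by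
          rw [← h5]; gcongr
      _ ≤ (L * ((C * D) ^ C * (p : ℝ) ^ (⌈C⌉₊ + 2)) + (p : ℝ) ^ (⌈C⌉₊ + 2)) +
          8 * (D : ℝ) ^ 2 * (p : ℝ) ^ (⌈C⌉₊ + 2) := by gcongr
      _ = _ := by ring

/-- A sequence of events whose probabilities tend to one for every fixed threshold can be
diagonalized. -/
theorem exists_tendsto_zero_of_forall_pos {F : ℕ → ℝ → ℝ≥0∞} (hF1 : ∀ n t, F n t ≤ 1)
    (hF : ∀ ε > 0, Tendsto (fun n => F n ε) atTop (𝓝 1)) :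
    ∃ δ : ℕ → ℝ, Tendsto δ atTop (𝓝 0) ∧ Tendsto (fun n => F n (δ n)) atTop (𝓝 1) := by
  have hpos : ∀ k : ℕ, (0 : ℝ) < 1 / (k + 1) := fun k => by positivity
  have hlt : ∀ k : ℕ, (1 : ℝ≥0∞) - (k + 1 : ℝ≥0∞)⁻¹ < 1 := fun k =>
    ENNReal.sub_lt_self ENNReal.one_ne_top one_ne_zero
      (ENNReal.inv_ne_zero.2 (by finiteness))
  classical
  -- `κ n` is the finest scale up to n at which the event already has probability at least 1 -
  -- 1/(k+1). The choice k = 0 always qualifies, since it demands only probability 0.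
  set κ : ℕ → ℕ := fun n =>
    Nat.findGreatest (fun k => 1 - (k + 1 : ℝ≥0∞)⁻¹ ≤ F n (1 / ((k : ℝ) + 1))) n with hκ
  have hκP : ∀ n, 1 - (κ n + 1 : ℝ≥0∞)⁻¹ ≤ F n (1 / ((κ n : ℝ) + 1)) := by
    intro n
    exact Nat.findGreatest_spec (P := fun k : ℕ => 1 - (k + 1 : ℝ≥0∞)⁻¹ ≤ F n (1 / ((k : ℝ) + 1)))
      (Nat.zero_le n) (by simp)
  have hκtop : Tendsto κ atTop atTop := by
    refine tendsto_atTop.2 fun m => ?_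
    filter_upwards [(hF _ (hpos m)).eventually (lt_mem_nhds (hlt m)), eventually_ge_atTop m]
      with n hn hmn
    exact Nat.le_findGreatest hmn hn.le
  refine ⟨fun n => 1 / ((κ n : ℝ) + 1), tendsto_one_div_add_atTop_nhds_zero_nat.comp hκtop, ?_⟩
  have hlim : Tendsto (fun k : ℕ => (1 : ℝ≥0∞) - (k + 1 : ℝ≥0∞)⁻¹) atTop (𝓝 1) := by
    have h1 : Tendsto (fun k : ℕ => ((k + 1 : ℕ) : ℝ≥0∞)⁻¹) atTop (𝓝 0) :=
      ENNReal.tendsto_inv_nat_nhds_zero.comp (tendsto_add_atTop_nat 1)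
    have h2 := ENNReal.Tendsto.sub (tendsto_const_nhds (x := (1 : ℝ≥0∞))) h1
      (Or.inl ENNReal.one_ne_top)
    simpa using h2
  exact tendsto_of_tendsto_of_tendsto_of_le_of_le (hlim.comp hκtop) tendsto_const_nhds hκP
    fun n => hF1 n _

end Asymptotics

/-! ### Strong convergence. -/

section StrongConvergence

variable {Λ : Type*} [Group Λ] {S : Finset Λ} {Ω : ℕ → Type*} [∀ n, MeasurableSpace (Ω n)]
  {P : ∀ n, Measure (Ω n)} [∀ n, IsProbabilityMeasure (P n)]
  {π : ∀ n, Ω n → Λ →* Matrix.unitaryGroup (Fin n) ℂ} {C : ℝ} {u : ℕ → Λ → ℝ}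

open Polynomial in
/-- For powers of a bump polynomial of order `log n`, the expected (unnormalized) trace is small
enough to overcome the smallness of the bump. -/
theorem expectation_bump_le (hS : Subgroup.closure (S : Set Λ) = ⊤)
    (hπ : ∀ (n : ℕ) (γ : Λ) (i j : Fin n),
      Measurable fun ω => (π n ω γ : Matrix (Fin n) (Fin n) ℂ) i j)
    (hexp : EffectiveExpansion S P π C u) {y : MonoidAlgebra ℂ Λ}
    (hy : ∀ n ω, (extendRep (π n ω) y).PosSemidef) (hy1 : ellOne Λ y ≤ 1) {K r : ℝ}
    (hr : 0 ≤ r) (hyr : regularNorm y ≤ r) (hK0 : 0 ≤ K)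
    (hK : ∀ j, ‖linearExt (u 1) (y ^ j)‖ ≤ K * r ^ j) {a b : ℕ}
    (hab : (bumpMajorant a b).eval r ≤ 1 / 16) :
    ∃ β : ℕ → ℝ, Tendsto β atTop (𝓝 0) ∧ ∀ᶠ n : ℕ in atTop,
      n * (∫ ω, normTrace (extendRep (π n ω) (aeval y (bump a b ^ Nat.log 4 n))) ∂(P n)).re /
        (1 / 2) ^ Nat.log 4 n ≤ β n := by
  obtain ⟨d, hd⟩ := exists_mem_supportedInBall (S := S) y
  -- The p-th power of the bump at `y` is supported in the ball of radius d·a·b·p; the extra 2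
  -- ensures that q = D p is at least 2. Below, L = 2^b because the majorant takes the value 2^b - 1
  -- at 1.
  set D := d * (a * b) + 2 with hD
  obtain ⟨A, k, M, hM⟩ := exists_threshold_le hexp.one_le
    (L := 2 ^ b) (one_le_pow₀ one_le_two) D
  -- With 4^p ≤ n < 4^(p+1), the u₀ term is at most 4 · 4^p · 16^(-p) · 2^p = 4 · 2^(-p), and the u₁
  -- term is at most K · 2^(-p). The remainder is polynomial in p times 2^p/n ≤ 2^(-p).
  set ζ : ℕ → ℝ := fun p => (4 + K) * (1 / 2) ^ p +
    65 * (D : ℝ) ^ 4 * A ^ 2 * ((p : ℝ) ^ (4 + 2 * k) * (1 / 2) ^ p) with hζ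
  have hζ0 : Tendsto ζ atTop (𝓝 0) := by
    have h1 := (tendsto_pow_mul_half_pow 0).const_mul (4 + K)
    have h2 := (tendsto_pow_mul_half_pow (4 + 2 * k)).const_mul (65 * (D : ℝ) ^ 4 * A ^ 2)
    simpa [hζ] using h1.add h2
  refine ⟨fun n => ζ (Nat.log 4 n), hζ0.comp tendsto_log_four, ?_⟩
  have hMle : ∀ᶠ p : ℕ in atTop, (M p : ℝ) ≤ 4 ^ p := by
    have h1 := (tendsto_pow_mul_half_pow k).const_mul A
    rw [mul_zero] at h1
    filter_upwards [h1.eventually (ge_mem_nhds zero_lt_one), eventually_ge_atTop 1] with p hp hp1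
    have h2 := (hM p hp1).2.2
    have h3 : A * (p : ℝ) ^ k ≤ 2 ^ p := by
      have : (2 : ℝ) ^ p * (1 / 2) ^ p = 1 := by rw [← mul_pow]; norm_num
      calc A * (p : ℝ) ^ k = (A * ((p : ℝ) ^ k * (1 / 2) ^ p)) * 2 ^ p := by
            linear_combination (-A * (p : ℝ) ^ k) * this
        _ ≤ 1 * 2 ^ p := by gcongr
        _ = 2 ^ p := one_mul _
    exact h2.trans (h3.trans (pow_le_pow_left₀ zero_le_two (by norm_num) p))
  filter_upwards [tendsto_log_four.eventually hMle, tendsto_log_four.eventually_ge_atTop 1,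
    eventually_ge_atTop 1] with n hMn hp1 hn1
  set p := Nat.log 4 n with hp
  obtain ⟨hM1, hM2, hM3⟩ := hM p hp1
  have h4n : (4 : ℝ) ^ p ≤ n := by exact_mod_cast Nat.pow_log_le_self 4 (by omega)
  have hn4 : (n : ℝ) ≤ 4 * 4 ^ p := by
    have : n < 4 ^ (p + 1) := Nat.lt_pow_succ_log_self (by norm_num) n
    have h : (n : ℝ) < 4 ^ (p + 1) := by exact_mod_cast this
    rw [pow_succ] at h; linarith
  have hn0 : (0 : ℝ) < n := by exact_mod_cast hn1
  set f := bump a b ^ p with hf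
  set z := aeval y f with hz
  have hdom : CoeffDominated f (bumpMajorant a b ^ p) := (coeffDominated_bump a b).pow p
  have hzmem : z ∈ supportedInBall S (D * p) := by
    refine supportedInBall_mono ?_ (aeval_mem_supportedInBall hS hd (k := p * (a * b)) ?_)
    · rw [hD]; nlinarith
    · exact natDegree_pow_le.trans (Nat.mul_le_mul_left _ (natDegree_bump_le a b))
  have hzL : ellOne Λ z ≤ (2 ^ b) ^ (D * p) := by
    have h1 : ellOne Λ z ≤ 1 * (bumpMajorant a b ^ p).eval 1 :=
      hdom.seminorm_aeval_le _ fun j => by simpa using ellOne_pow_le_one hy1 j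
    rw [one_mul, eval_pow, eval_bumpMajorant, one_pow, one_add_one_eq_two] at h1
    have h2 : (1 : ℝ) ≤ 2 ^ b := one_le_pow₀ one_le_two
    calc ellOne Λ z ≤ (2 ^ b - 1) ^ p := h1
      _ ≤ (2 ^ b) ^ p := pow_le_pow_left₀ (by linarith) (by linarith) p
      _ ≤ (2 ^ b) ^ (D * p) := pow_le_pow_right₀ h2 (Nat.le_mul_of_pos_left p (by omega))
  have hfI : ∀ t ∈ Set.Icc (0 : ℝ) 1, f.eval t ∈ Set.Icc (0 : ℝ) 1 := by
    intro t ht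
    have := eval_bump_mem_Icc a b ht
    rw [hf, eval_pow]
    exact ⟨pow_nonneg this.1 _, pow_le_one₀ this.1 this.2⟩
  have hz1 : ∀ n, |(∫ ω, normTrace (extendRep (π n ω) z) ∂(P n)).re| ≤ 1 := by
    intro n
    have hre : (∫ ω, normTrace (extendRep (π n ω) z) ∂(P n)).re =
        ∫ ω, (normTrace (extendRep (π n ω) z)).re ∂(P n) :=
      (integral_re (integrable_normTrace_extendRep (hπ n) z)).symm
    rw [hre, ← Real.norm_eq_abs]
    have h1 := norm_integral_le_of_norm_le_const (μ := P n) (C := 1)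
      (f := fun ω => (normTrace (extendRep (π n ω) z)).re) (Eventually.of_forall fun ω => by
        have := normTrace_aeval_mem_Icc (π n ω) (hy n ω) hy1 hfI
        rw [Real.norm_of_nonneg this.1]; exact this.2)
    simpa using h1
  have hmain := hexp.abs_expectation_sub_le hπ (q := D * p) (M := M p)
    ((by omega : 2 ≤ D * 1).trans (Nat.mul_le_mul_left D hp1)) hzmem
    (one_le_pow₀ one_le_two) hzL hz1 hM1 hM2 (n := n) (by exact_mod_cast hMn.trans h4n)
  have hW : (bumpMajorant a b ^ p).eval r ≤ (1 / 16) ^ p := by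
    rw [eval_pow]
    refine pow_le_pow_left₀ ?_ hab p
    rw [eval_bumpMajorant]
    have : (1 : ℝ) ≤ (1 + r ^ a) ^ b :=
      one_le_pow₀ (by have := pow_nonneg hr a; linarith)
    linarith
  have hu0 : (linearExt (u 0) z).re ≤ (1 / 16) ^ p := by
    refine (Complex.re_le_norm _).trans ((norm_linearExt_aeval_le (K := 1) (r := r) ?_ hdom).trans
      (by rwa [one_mul]))
    intro j
    rw [linearExt_eq_linExt, one_mul]
    simp_rw [hexp.zeroth]
    exact (norm_linExt_canonicalTrace_pow_le y j).trans (pow_le_pow_left₀ (norm_nonneg _) hyr j)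
  have hu1 : (linearExt (u 1) z).re ≤ K * (1 / 16) ^ p :=
    (Complex.re_le_norm _).trans ((norm_linearExt_aeval_le hK hdom).trans (by gcongr))
  set e := (∫ ω, normTrace (extendRep (π n ω) z) ∂(P n)).re with he
  set R := 65 * ((D * p : ℕ) : ℝ) ^ 4 * (M p : ℝ) ^ 2 with hR
  have hR0 : 0 ≤ R := by positivity
  have h2p : (0 : ℝ) < 2 ^ p := by positivity
  have hne : n * e ≤ n * (1 / 16) ^ p + K * (1 / 16) ^ p + R / 4 ^ p := by
    have h1 : e ≤ (1 / 16) ^ p + K * (1 / 16) ^ p / n + R / n ^ 2 := by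
      have h2 := (abs_le.1 hmain).2
      have h3 : (linearExt (u 1) z).re / n ≤ K * (1 / 16) ^ p / n := by gcongr
      linarith
    calc n * e ≤ n * ((1 / 16) ^ p + K * (1 / 16) ^ p / n + R / n ^ 2) := by gcongr
      _ = n * (1 / 16) ^ p + K * (1 / 16) ^ p + R / n := by field_simp
      _ ≤ _ := by gcongr
  have hRle : R ≤ 65 * (D : ℝ) ^ 4 * A ^ 2 * (p : ℝ) ^ (4 + 2 * k) := by
    calc R = 65 * ((D : ℝ) * p) ^ 4 * (M p : ℝ) ^ 2 := by rw [hR]; push_cast; rfl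
      _ ≤ 65 * ((D : ℝ) * p) ^ 4 * (A * (p : ℝ) ^ k) ^ 2 := by gcongr
      _ = _ := by rw [pow_add, pow_mul']; ring
  have e1 : (1 / 16 : ℝ) ^ p = (1 / 2) ^ p * (1 / 2) ^ p * (1 / 4) ^ p := by
    rw [← mul_pow, ← mul_pow]; norm_num
  have e2 : (4 : ℝ) ^ p * (1 / 4) ^ p = 1 := by rw [← mul_pow]; norm_num
  have e3 : (1 / 4 : ℝ) ^ p = (1 / 2) ^ p * (1 / 2) ^ p := by rw [← mul_pow]; norm_num
  have e4 : R / 4 ^ p = R * (1 / 4) ^ p := by rw [one_div, inv_pow, div_eq_mul_inv]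
  have hh : (0 : ℝ) < (1 / 2) ^ p := by positivity
  have hh1 : (1 / 2 : ℝ) ^ p ≤ 1 := pow_le_one₀ (by norm_num) (by norm_num)
  have hq0 : (0 : ℝ) < (1 / 4) ^ p := by positivity
  have hq1 : (1 / 4 : ℝ) ^ p ≤ 1 := pow_le_one₀ (by norm_num) (by norm_num)
  rw [div_le_iff₀ hh]
  refine hne.trans ?_
  set s : ℝ := (1 / 2) ^ p with hs
  set t : ℝ := (1 / 4) ^ p with ht
  have t1 : n * (1 / 16 : ℝ) ^ p ≤ 4 * s * s := by
    rw [e1]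
    calc n * (s * s * t) ≤ (4 * 4 ^ p) * (s * s * t) := by gcongr
      _ = 4 * s * s * (4 ^ p * t) := by ring
      _ = 4 * s * s := by rw [e2, mul_one]
  have t2 : K * (1 / 16 : ℝ) ^ p ≤ K * s * s := by
    rw [e1]
    calc K * (s * s * t) ≤ K * (s * s * 1) := by gcongr
      _ = _ := by ring
  have t3 : R / 4 ^ p ≤ 65 * (D : ℝ) ^ 4 * A ^ 2 * (p : ℝ) ^ (4 + 2 * k) * (s * s) := by
    rw [e4, e3]; gcongr
  calc _ ≤ 4 * s * s + K * s * s + 65 * (D : ℝ) ^ 4 * A ^ 2 * (p : ℝ) ^ (4 + 2 * k) * (s * s) := by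
        linarith
    _ = ζ p * s := by rw [hζ]; ring

/-- Strong convergence for elements that are positive in a strong sense. -/
theorem tendsto_prob_of_posSemidef (hS : Subgroup.closure (S : Set Λ) = ⊤)
    (hπ : ∀ (n : ℕ) (γ : Λ) (i j : Fin n),
      Measurable fun ω => (π n ω γ : Matrix (Fin n) (Fin n) ℂ) i j)
    (hexp : EffectiveExpansion S P π C u) (htemp : Tempered (u 1)) {y : MonoidAlgebra ℂ Λ}
    (hy : ∀ n ω, (extendRep (π n ω) y).PosSemidef) (hy1 : ellOne Λ y ≤ 1)
    (hsa : involution y = y) {r₁ : ℝ} (hr₁ : regularNorm y < r₁) :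
    Tendsto (fun n => P n {ω | repNorm (π n ω) y ≤ r₁}) atTop (𝓝 1) := by
  -- For r₁ ≥ 1 the ℓ¹ bound already suffices; otherwise r₀ strictly between ‖λ(y)‖ and r₁ leaves
  -- room for both temperedness and the bump.
  rcases le_or_gt 1 r₁ with h1 | h1
  · have : ∀ n, P n {ω | repNorm (π n ω) y ≤ r₁} = 1 := fun n => by
      rw [Set.eq_univ_of_forall (s := {ω | repNorm (π n ω) y ≤ r₁}) fun ω =>
        (repNorm_le_ellOne _ y).trans (hy1.trans h1), measure_univ]
    simp [this]
  obtain ⟨r₀, hr₀, hr₀₁⟩ := exists_between hr₁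
  have hr0 : 0 ≤ r₀ := (norm_nonneg _).trans hr₀.le
  obtain ⟨K, hK0, hK⟩ := htemp.exists_bound hsa hr₀
  obtain ⟨a, b, hab, hbump⟩ := exists_bump hr0 hr₀₁ h1.le
  obtain ⟨β, hβ, hβn⟩ := expectation_bump_le hS hπ hexp hy hy1 hr0 hr₀.le hK0 hK hab
  have hlim : Tendsto (fun n => ENNReal.ofReal (1 - β n)) atTop (𝓝 1) := by
    have := ENNReal.tendsto_ofReal ((tendsto_const_nhds (x := (1 : ℝ))).sub hβ)
    simpa using this
  refine tendsto_of_tendsto_of_tendsto_of_le_of_le' hlim tendsto_const_nhds ?_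
    (Eventually.of_forall fun n => prob_le_one)
  filter_upwards [hβn, eventually_ge_atTop 1] with n hn hn1
  refine le_trans (ENNReal.ofReal_le_ofReal (sub_le_sub_left hn 1)) ?_
  refine prob_repNorm_gt_le (hπ n) (hy n) hy1 (fun t ht => ?_) (hr0.trans hr₀₁.le)
    (by positivity) (fun t ht => ?_) hn1
  · have := eval_bump_mem_Icc a b ht
    rw [Polynomial.eval_pow]
    exact ⟨pow_nonneg this.1 _, pow_le_one₀ this.1 this.2⟩
  · rw [Polynomial.eval_pow]
    exact pow_le_pow_left₀ (by norm_num) (hbump t ht) _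

/-- Passing to c x*x squares and rescales both norms in the same way, so the bound for x is
equivalent to one for a positive element of ℓ¹ norm at most 1. The added 1 in the definition of `c`
covers x = 0. -/
theorem tendsto_prob_repNorm_le (hS : Subgroup.closure (S : Set Λ) = ⊤)
    (hπ : ∀ (n : ℕ) (γ : Λ) (i j : Fin n),
      Measurable fun ω => (π n ω γ : Matrix (Fin n) (Fin n) ℂ) i j)
    (hexp : EffectiveExpansion S P π C u) (htemp : Tempered (u 1)) (x : MonoidAlgebra ℂ Λ)
    {ε : ℝ} (hε : 0 < ε) :
    Tendsto (fun n => P n {ω | repNorm (π n ω) x ≤ regularNorm x + ε}) atTop (𝓝 1) := by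
  set c : ℝ := (ellOne Λ x ^ 2 + 1)⁻¹ with hc
  have hc0 : 0 < c := by positivity
  have hx0 : 0 ≤ regularNorm x := norm_nonneg _
  have hy1 : ellOne Λ (c • (involution x * x)) ≤ 1 := by
    rw [map_smul_eq_mul, Real.norm_of_nonneg hc0.le, hc, inv_mul_le_iff₀ (by positivity), mul_one]
    have h1 := ellOne_mul_le (involution x) x
    have h2 := mul_le_mul_of_nonneg_right (ellOne_involution_le x) (apply_nonneg (ellOne Λ) x)
    nlinarith
  have hsa : involution (c • (involution x * x)) = c • (involution x * x) := by
    rw [involution_real_smul, involution_mul, involution_involution]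
  have hr : regularNorm (c • (involution x * x)) < c * (regularNorm x + ε) ^ 2 := by
    rw [regularNorm_real_smul hc0.le, regularNorm_involution_mul_self]
    gcongr; linarith
  have h := tendsto_prob_of_posSemidef hS hπ hexp htemp
    (fun n ω => posSemidef_extendRep (π n ω) hc0.le x) hy1 hsa hr
  have heq : ∀ n ω, repNorm (π n ω) (c • (involution x * x)) ≤ c * (regularNorm x + ε) ^ 2 ↔
      repNorm (π n ω) x ≤ regularNorm x + ε := by
    intro n ω
    have h0 : 0 ≤ repNorm (π n ω) x := norm_nonneg _
    rw [repNorm_real_smul _ hc0.le, repNorm_involution_mul_self, mul_le_mul_iff_right₀ hc0,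
      sq_le_sq₀ h0 (by positivity)]
  simpa only [heq] using h

end StrongConvergence

end StrongConv

theorem theorem1p3 {Λ : Type*} [Group Λ]
    (S : Finset Λ) (hS : Subgroup.closure (S : Set Λ) = ⊤)
    {Ω : ℕ → Type*} [∀ n, MeasurableSpace (Ω n)]
    (P : ∀ n, Measure (Ω n)) [∀ n, IsProbabilityMeasure (P n)]
    (π : ∀ n, Ω n → Λ →* Matrix.unitaryGroup (Fin n) ℂ)
    (hπ : ∀ (n : ℕ) (γ : Λ) (i j : Fin n),
      Measurable fun ω => (π n ω γ : Matrix (Fin n) (Fin n) ℂ) i j)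
    (C : ℝ) (u : ℕ → Λ → ℝ)
    (hexp : StrongConv.EffectiveExpansion S P π C u)
    (htemp : StrongConv.Tempered (u 1))
    (x : MonoidAlgebra ℂ Λ) :
    ∃ δ : ℕ → ℝ, Tendsto δ atTop (𝓝 0) ∧
      Tendsto
        (fun n => P n {ω | StrongConv.repNorm (π n ω) x ≤ StrongConv.regularNorm x + δ n})
        atTop (𝓝 1) :=
  StrongConv.exists_tendsto_zero_of_forall_pos
    (F := fun n ε => P n {ω | StrongConv.repNorm (π n ω) x ≤ StrongConv.regularNorm x + ε})
    (fun _ _ => prob_le_one)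
    fun _ hε => StrongConv.tendsto_prob_repNorm_le hS hπ hexp htemp x hε
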